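/- **Theorem.** Graphs are multigraphs: loops (cycles of length $1$) and parallel edges (pairs of which form cycles of length $2$) are allowed. A *cactus graph* is a finite connected graph in which no two distinct cycles share an edge. For a finite graph $G$ with edge set $E$ let $M(G)$ be its cycle matroid (a set of edges is independent if and only if it contains no cycle), with rank function $\mathrm{rk}$. Its higher weights are $$d_i(M(G))=\min\{|\tau| : \tau\subseteq E,\ |\tau|-\mathrm{rk}(\tau)=i\},\qquad i\ge 0,$$ where $d_i(M(G))$ is left undefined (put $d_i(M(G))=\infty$) if no such $\tau$ exists. Fix a field $k$. The facet ideal of $M(G)$ is the ideal $$\mathcal F(M(G))=\Big\langle \prod_{e\in\sigma}x_e : \sigma \text{ a basis of } M(G)\Big\rangle\subseteq S=k[x_e : e\in E].$$ A minimal (ungraded) free resolution of an $S$-module $N$ is a complex $0\leftarrow S^{\beta_0}\leftarrow S^{\beta_1}\leftarrow S^{\beta_2}\leftarrow\cdots$, exact except at $S^{\beta_0}$, where the cokernel of $S^{\beta_1}\to S^{\beta_0}$ is isomorphic to $N$, and such that the image of each map $S^{\beta_{i+1}}\to S^{\beta_i}$ lies in $\langle x_e : e\in E\rangle S^{\beta_i}$;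 the numbers $\beta_i$ are the Betti numbers of $N$. Let $G$ and $H$ be cactus graphs. Then $\mathcal F(M(G))$ and $\mathcal F(M(H))$ have minimal free resolutions, and their sequences of Betti numbers $(\beta_i)_{i\ge0}$ and $(\gamma_i)_{i\ge0}$ are uniquely determined. Moreover: 1. If $G$ and $H$ are loop-free and $\beta_i=\gamma_i$ for all $i$, then $d_i(M(G))=d_i(M(H))$ for all $i$. That is, the Betti numbers of the facet ideal determine the higher weight hierarchy. 2. Conversely, if $d_i(M(G))=d_i(M(H))$ for all $i$, then $\beta_i=\gamma_i$ for all $i$. That is, the higher weight hierarchy determines the Betti numbers. -/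

import Mathlib

namespace Graph

/-- `C` is the edge set of a cycle of the multigraph `G`: there are `n + 1 ≥ 1` distinct vertices
`v 0, …, v n` and `n + 1` distinct edges `e 0, …, e n`, such that `e i` joins `v i` and `v (i + 1)`,
indices being taken cyclically.  A loop is a cycle of length one, and two parallel edges form a
cycle of length two. -/
def IsCycleSet {α β : Type*} (G : Graph α β) (C : Set β) : Prop :=
  ∃ (n : ℕ) (v : Fin (n + 1) → α) (e : Fin (n + 1) → β),
    Function.Injective v ∧ Function.Injective e ∧
      (∀ i, G.IsLink (e i) (v i) (v (i + 1))) ∧ Set.range e = C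

/-- A set of edges of `G` that contains (the edge set of) no cycle. -/
def IsAcyclicSet {α β : Type*} (G : Graph α β) (I : Set β) : Prop :=
  I ⊆ G.edgeSet ∧ ∀ C ⊆ I, ¬ G.IsCycleSet C

/-- The multigraph `G` is connected: it has a vertex, and any two vertices are joined by a walk. -/
def IsConnected {α β : Type*} (G : Graph α β) : Prop :=
  G.vertexSet.Nonempty ∧
    ∀ x ∈ G.vertexSet, ∀ y ∈ G.vertexSet, Relation.ReflTransGen G.Adj x y

/-- A cactus graph: a finite, connected multigraph (loops and parallel edges allowed) such that no
two distinct cycles share an edge. -/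
structure IsCactus {α β : Type*} (G : Graph α β) : Prop where
  finite_vertexSet : G.vertexSet.Finite
  finite_edgeSet : G.edgeSet.Finite
  connected : G.IsConnected
  disjoint_cycles : ∀ C D, G.IsCycleSet C → G.IsCycleSet D → C ≠ D → Disjoint C D

/-! ### The cycle matroid

The acyclic edge sets satisfy the matroid axioms.  For the proof they are compared with linear
independence, over the field with two elements, of the columns of the incidence matrix. -/

open Classical in
/-- The column of the incidence matrix of `G` over the field with two elements at the edge `e`. -/
noncomputable def incVec {α β : Type*} (G : Graph α β) (e : β) : α →₀ ZMod 2 :=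
  if h : ∃ p : α × α, G.IsLink e p.1 p.2 then
    Finsupp.single h.choose.1 1 + Finsupp.single h.choose.2 1 else 0

lemma incVec_eq {α β : Type*} (G : Graph α β) {e : β} {x y : α} (h : G.IsLink e x y) :
    G.incVec e = Finsupp.single x 1 + Finsupp.single y 1 := by
  have h' : ∃ p : α × α, G.IsLink e p.1 p.2 := ⟨(x, y), h⟩
  rw [incVec, dif_pos h']
  obtain ⟨h1, h2⟩ | ⟨h1, h2⟩ := h'.choose_spec.eq_and_eq_or_eq_and_eq h
  · rw [h1, h2]
  · rw [h1, h2, add_comm]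

lemma IsCycleSet.not_linearIndepOn {α β : Type*} {G : Graph α β} {C : Set β}
    (hC : G.IsCycleSet C) : ¬ LinearIndepOn (ZMod 2) G.incVec C := by
  obtain ⟨n, v, e, -, he, hl, rfl⟩ := hC
  rw [linearIndepOn_range_iff he]
  intro h
  rw [Fintype.linearIndependent_iff] at h
  have h1 := h (fun _ => 1) ?_ 0
  · exact one_ne_zero h1
  · simp only [one_smul, Function.comp_apply]
    have hshift := Equiv.sum_comp (Equiv.addRight (1 : Fin (n + 1)))
      (fun i => (Finsupp.single (v i) (1 : ZMod 2)))
    simp only [Equiv.coe_addRight] at hshift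
    rw [Finset.sum_congr rfl fun i _ => G.incVec_eq (hl i), Finset.sum_add_distrib, hshift]
    ext x
    simpa using CharTwo.add_self_eq_zero _

/-- An infinite walk in a finite edge set that never turns back immediately contains a cycle. -/
lemma exists_isCycleSet_of_walk {α β : Type*} (G : Graph α β) (T : Set β) (hT : T.Finite)
    (v : ℕ → α) (e : ℕ → β) (heT : ∀ i, e i ∈ T) (hl : ∀ i, G.IsLink (e i) (v i) (v (i + 1)))
    (hne : ∀ i, e (i + 1) ≠ e i) : ∃ C ⊆ T, G.IsCycleSet C := by
  classical
  have hfin : (⋃ f ∈ T, {x | G.Inc f x}).Finite := by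
    refine hT.biUnion fun f _ => ?_
    by_cases hf : ∃ x y, G.IsLink f x y
    · obtain ⟨x, y, hxy⟩ := hf
      exact (Set.toFinite {x, y}).subset fun z hz => hz.eq_or_eq_of_isLink hxy
    · convert Set.finite_empty
      ext z
      simp only [Set.mem_ofPred_eq, Set.mem_empty_iff_false, iff_false]
      rintro ⟨y, hy⟩
      exact hf ⟨z, y, hy⟩
  have hrep : ∃ p i, v i = v (i + p + 1) := by
    have hninj : ¬ Function.Injective v := fun hinj =>
      Set.infinite_of_injective_forall_mem hinj
        (fun i => Set.mem_biUnion (heT i) (hl i).inc_left) hfin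
    simp only [Function.Injective, not_forall] at hninj
    obtain ⟨i, j, hij, hne'⟩ := hninj
    rcases lt_or_gt_of_ne hne' with h | h
    · exact ⟨j - i - 1, i, by rw [hij]; congr 1; omega⟩
    · exact ⟨i - j - 1, j, by rw [← hij]; congr 1; omega⟩
  obtain ⟨i, hi⟩ := Nat.find_spec hrep
  have hmin := fun {m} => Nat.find_min hrep (m := m)
  generalize Nat.find hrep = n at hi hmin
  have hv : ∀ a b : ℕ, a < b → b ≤ n → v (i + a) ≠ v (i + b) := by
    intro a b hab hb h
    refine hmin (m := b - a - 1) (by omega) ⟨i + a, ?_⟩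
    rw [h]; congr 1; omega
  have hE : ∀ a b : ℕ, a < b → b ≤ n → e (i + a) ≠ e (i + b) := by
    intro a b hab hb h
    have h1 := hl (i + a)
    rw [h] at h1
    rcases h1.eq_and_eq_or_eq_and_eq (hl (i + b)) with ⟨h2, _⟩ | ⟨h2, h3⟩
    · exact hv a b hab hb h2
    · rcases Nat.eq_or_lt_of_le hb with rfl | hb'
      · rcases Nat.eq_or_lt_of_le (Nat.succ_le_of_lt hab) with rfl | hab'
        · exact hne (i + a) h.symm
        · exact hv (a + 1) b hab' le_rfl h3
      · exact hv a (b + 1) (by omega) hb' h2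
  refine ⟨Set.range fun a : Fin (n + 1) => e (i + a), ?_, n, fun a => v (i + a),
    fun a => e (i + a), ?_, ?_, ?_, rfl⟩
  · rintro _ ⟨a, rfl⟩
    exact heT _
  · intro a b hab
    by_contra hne'
    rcases lt_or_gt_of_ne hne' with h | h
    · exact hv a b h (by omega) hab
    · exact hv b a h (by omega) hab.symm
  · intro a b hab
    by_contra hne'
    rcases lt_or_gt_of_ne hne' with h | h
    · exact hE a b h (by omega) hab
    · exact hE b a h (by omega) hab.symm
  · intro a
    have h := hl (i + a)
    by_cases ha : a = Fin.last n
    · subst ha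
      simp only [Fin.last_add_one, Fin.val_last, Fin.val_zero, add_zero] at h ⊢
      rwa [hi]
    · beta_reduce
      rw [Fin.val_add_one, if_neg ha]
      exact h

lemma IsAcyclicSet.linearIndepOn {α β : Type*} {G : Graph α β} {I : Set β}
    (hI : G.IsAcyclicSet I) : LinearIndepOn (ZMod 2) G.incVec I := by
  classical
  rw [linearIndepOn_iff]
  intro l hl hl0
  by_contra hne
  have hTI : (l.support : Set β) ⊆ I := hl
  have step : ∀ e ∈ l.support, ∀ x y, G.IsLink e x y →
      ∃ e' ∈ l.support, e' ≠ e ∧ ∃ z, G.IsLink e' y z := by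
    intro e he x y hxy
    have hxne : x ≠ y := by
      rintro rfl
      refine hI.2 {e} (by simpa using hTI he) ⟨0, fun _ => x, fun _ => e, ?_, ?_, fun _ => hxy, ?_⟩
      · exact fun a b _ => Subsingleton.elim (α := Fin 1) a b
      · exact fun a b _ => Subsingleton.elim (α := Fin 1) a b
      · simp
    have hsum : ∑ f ∈ l.support, l f * G.incVec f y = 0 := by
      have := DFunLike.congr_fun hl0 y
      simpa [Finsupp.linearCombination_apply, Finsupp.sum, Finsupp.finsetSum_apply] using this
    have hey : l e * G.incVec e y ≠ 0 := by
      rw [G.incVec_eq hxy]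
      simpa [Finsupp.single_apply, hxne] using he
    have hex : ∃ f ∈ l.support.erase e, l f * G.incVec f y ≠ 0 := by
      by_contra! hall
      rw [← Finset.add_sum_erase _ _ he, Finset.sum_eq_zero hall, add_zero] at hsum
      exact hey hsum
    obtain ⟨f, hf, hfy⟩ := hex
    obtain ⟨hfe, hfl⟩ := Finset.mem_erase.1 hf
    refine ⟨f, hfl, hfe, ?_⟩
    obtain ⟨a, b, hab⟩ := G.exists_isLink_of_mem_edgeSet (hI.1 (hTI hfl))
    have h2 := right_ne_zero_of_mul hfy
    rw [G.incVec_eq hab] at h2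
    by_cases ha : a = y
    · exact ⟨b, ha ▸ hab⟩
    by_cases hb : b = y
    · exact ⟨a, hb ▸ hab.symm⟩
    · simp [ha, hb] at h2
  obtain ⟨e₀, he₀⟩ := Finsupp.support_nonempty_iff.2 hne
  obtain ⟨x₀, y₀, hxy₀⟩ := G.exists_isLink_of_mem_edgeSet (hI.1 (hTI he₀))
  let P := {p : α × β × α // p.2.1 ∈ l.support ∧ G.IsLink p.2.1 p.1 p.2.2}
  have hnext : ∀ p : P, ∃ q : P, q.1.1 = p.1.2.2 ∧ q.1.2.1 ≠ p.1.2.1 := by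
    rintro ⟨⟨x, e, y⟩, he, hxy⟩
    obtain ⟨e', he', hne', z, hz⟩ := step e he x y hxy
    exact ⟨⟨⟨y, e', z⟩, he', hz⟩, rfl, hne'⟩
  choose next hnext1 hnext2 using hnext
  let s : ℕ → P := fun n => next^[n] ⟨⟨x₀, e₀, y₀⟩, he₀, hxy₀⟩
  have hs : ∀ n, s (n + 1) = next (s n) := fun n => Function.iterate_succ_apply' _ _ _
  obtain ⟨C, hC, hcyc⟩ := G.exists_isCycleSet_of_walk (l.support : Set β) l.support.finite_toSet
    (fun n => (s n).1.1) (fun n => (s n).1.2.1) (fun n => (s n).2.1)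
    (fun n => by
      have h := (s n).2.2
      simp only [hs, hnext1]
      exact h)
    (fun n => by simp only [hs]; exact hnext2 _)
  exact hI.2 C (hC.trans hTI) hcyc

lemma isAcyclicSet_iff_linearIndepOn {α β : Type*} {G : Graph α β} {I : Set β} :
    G.IsAcyclicSet I ↔ I ⊆ G.edgeSet ∧ LinearIndepOn (ZMod 2) G.incVec I :=
  ⟨fun h => ⟨h.1, h.linearIndepOn⟩,
    fun h => ⟨h.1, fun _ hC hcyc => hcyc.not_linearIndepOn (h.2.mono hC)⟩⟩

lemma IsAcyclicSet.exists_insert {α β : Type*} {G : Graph α β} {I J : Set β}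
    (hI : G.IsAcyclicSet I) (hIf : I.Finite) (hJ : G.IsAcyclicSet J) (hJf : J.Finite)
    (hlt : I.ncard < J.ncard) : ∃ e ∈ J, e ∉ I ∧ G.IsAcyclicSet (insert e I) := by
  classical
  by_contra! hcon
  have hspan : ∀ e ∈ J, G.incVec e ∈ Submodule.span (ZMod 2) (G.incVec '' I) := by
    intro e he
    by_cases heI : e ∈ I
    · exact Submodule.subset_span ⟨e, heI, rfl⟩
    · by_contra hns
      exact hcon e he heI (isAcyclicSet_iff_linearIndepOn.2
        ⟨Set.insert_subset (hJ.1 he) hI.1, hI.linearIndepOn.insert hns⟩)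
  have := hIf.fintype
  have := hJf.fintype
  have h1 := finrank_span_eq_card (R := ZMod 2) (hJ.linearIndepOn : LinearIndependent _ _)
  have h2 := finrank_span_eq_card (R := ZMod 2) (hI.linearIndepOn : LinearIndependent _ _)
  have h3 : Set.range (fun x : I => G.incVec x) = G.incVec '' I := by
    rw [Set.image_eq_range]
  have hfd : FiniteDimensional (ZMod 2) (Submodule.span (ZMod 2) (G.incVec '' I)) :=
    FiniteDimensional.span_of_finite _ (hIf.image _)
  have h4 : Submodule.span (ZMod 2) (Set.range (fun x : J => G.incVec x)) ≤
      Submodule.span (ZMod 2) (G.incVec '' I) := by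
    rw [Submodule.span_le]
    rintro _ ⟨x, rfl⟩
    exact hspan x x.2
  have h5 := Submodule.finrank_mono h4
  rw [h1, ← h3, h2] at h5
  rw [Set.ncard_eq_toFinset_card', Set.ncard_eq_toFinset_card', Set.toFinset_card,
    Set.toFinset_card] at hlt
  omega

/-- The cycle matroid `M(G)`: the ground set is the edge set of `G`, and a set of edges is
independent if and only if it contains no cycle of `G`. -/
noncomputable def cycleMatroid {α β : Type*} (G : Graph α β) : Matroid β :=
  (IndepMatroid.ofFinitaryCardAugment G.edgeSet G.IsAcyclicSet
    ⟨Set.empty_subset _, fun C hC hcyc => by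
      obtain ⟨n, v, e, -, -, -, rfl⟩ := hcyc
      exact hC (Set.mem_range_self 0)⟩
    (fun _ _ hJ hIJ => ⟨hIJ.trans hJ.1, fun C hC => hJ.2 C (hC.trans hIJ)⟩)
    (fun _ _ hI hIf hJ hJf hlt => hI.exists_insert hIf hJ hJf hlt)
    (fun I h => ⟨fun e he => (h {e} (by simpa using he) (Set.finite_singleton e)).1 rfl,
      fun C hC hcyc => by
        have hfin : C.Finite := by
          obtain ⟨n, v, e, -, -, -, rfl⟩ := hcyc
          exact Set.finite_range e
        exact (h C hC hfin).2 C subset_rfl hcyc⟩)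
    (fun _ h => h.1)).matroid

@[simp] lemma cycleMatroid_ground {α β : Type*} (G : Graph α β) :
    G.cycleMatroid.E = G.edgeSet := rfl

@[simp] lemma cycleMatroid_indep {α β : Type*} (G : Graph α β) (I : Set β) :
    G.cycleMatroid.Indep I ↔ I ⊆ G.edgeSet ∧ ∀ C ⊆ I, ¬ G.IsCycleSet C := Iff.rfl

end Graph

namespace Matroid

/-- The `i`-th higher weight
`d_i(M) = min {|τ| : τ ⊆ E(M), |τ| - rk(τ) = i}`.
It takes values in `ℕ∞`; the value is `⊤` exactly when the set is empty (for a matroid on a finite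
ground set), i.e. when `d_i(M)` does not exist. -/
noncomputable def higherWeight {α : Type*} (M : Matroid α) (i : ℕ) : ℕ∞ :=
  sInf {m | ∃ τ ⊆ M.E, τ.encard = M.eRk τ + i ∧ m = τ.encard}

/-- The facet ideal of a matroid in the polynomial ring `k[x_e : e ∈ E(M)]`: it is generated by the
squarefree monomials `∏_{e ∈ σ} x_e`, where `σ` runs through the bases of `M`. -/
noncomputable def facetIdeal (k : Type*) [Field k] {α : Type*} (M : Matroid α) :
    Ideal (MvPolynomial M.E k) :=
  Ideal.span {p | ∃ σ : Finset M.E,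
    M.IsBase (Subtype.val '' (σ : Set M.E)) ∧ p = ∏ e ∈ σ, MvPolynomial.X e}

end Matroid

/-- The module `N` over the polynomial ring `S = k[x_s : s ∈ ι]` has a minimal (ungraded) free
resolution
`0 ← S^{β 0} ← S^{β 1} ← S^{β 2} ← ⋯`
in which the free modules have ranks `β 0, β 1, β 2, …`.  Here `d i : S^{β (i+1)} → S^{β i}` are the
boundary maps and `ε : S^{β 0} → N` is the augmentation, which identifies the cokernel of `d 0` with
`N`; minimality says that the image of each boundary map lies in `𝔪 S^{β i}`, where `𝔪` is the ideal
generated by the variables. -/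
def IsBettiSequence {ι k : Type*} [Field k] (N : Type*) [AddCommGroup N]
    [Module (MvPolynomial ι k) N] (β : ℕ → ℕ) : Prop :=
  ∃ (d : ∀ i, (Fin (β (i + 1)) → MvPolynomial ι k) →ₗ[MvPolynomial ι k]
        (Fin (β i) → MvPolynomial ι k))
    (ε : (Fin (β 0) → MvPolynomial ι k) →ₗ[MvPolynomial ι k] N),
    Function.Surjective ε ∧ Function.Exact (d 0) ε ∧
      (∀ i, Function.Exact (d (i + 1)) (d i)) ∧
      ∀ i, LinearMap.range (d i) ≤
        Ideal.span (Set.range (MvPolynomial.X : ι → MvPolynomial ι k)) •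
          (⊤ : Submodule (MvPolynomial ι k) (Fin (β i) → MvPolynomial ι k))

/-! In a cactus the circuits of the cycle matroid are pairwise disjoint, and everything follows from
their sizes. Removing one element from each circuit contained in a set `τ` leaves a basis of `τ`, so
`|τ| - rk τ` counts the circuits inside `τ`. Hence `d_i` is the sum of the `i` smallest circuit
sizes (`HasDisjointCircuits.higherWeight_eq`), and the hierarchy and the multiset of sizes determine
each other.

For the same reason the bases are the complements of the transversals of the circuits. The facet
ideal is therefore a squarefree monomial times a product of ideals `I_C`, where `I_C` is generated
by the products of all but one of the variables of `C` (`facetIdeal_eq`). Different factors use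
different variables. Multiplying an ideal by such an `I_C` with `|C| = n + 1` amounts to taking the
cokernel of a matrix with `n` columns and `n + 1` rows, which acts injectively on the ideal; a
mapping cone then gives a minimal resolution (`HasMinimalResolution.mul_span_prod_erase`). By
induction the Betti numbers are the coefficients of `∏ (|C| + (|C| - 1) X)`.

This polynomial depends only on the sizes. Conversely, its roots recover every size that is at least
two; a loop contributes the factor `1` and is invisible, which is why the first direction concerns
loop-free graphs. Uniqueness of the Betti numbers comes from Schanuel's lemma and reduction modulo
the ideal of the variables. -/

/-! ### Uniqueness of Betti numbers -/

section MinimalResolution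

universe u

variable {R : Type u} [CommRing R] {m : Ideal R}

/-- `N` has a free resolution with ranks `β` whose differentials have image in `m` times the
target. -/
def HasMinimalResolution (m : Ideal R) (N : Type*) [AddCommGroup N] [Module R N]
    (β : ℕ → ℕ) : Prop :=
  ∃ (d : ∀ i, (Fin (β (i + 1)) → R) →ₗ[R] (Fin (β i) → R)) (ε : (Fin (β 0) → R) →ₗ[R] N),
    Function.Surjective ε ∧ Function.Exact (d 0) ε ∧
      (∀ i, Function.Exact (d (i + 1)) (d i)) ∧
      ∀ i, LinearMap.range (d i) ≤ m • (⊤ : Submodule R (Fin (β i) → R))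

lemma LinearMap.baseChange_eq_zero_of_range_le (A : Type*) [CommRing A] [Algebra R A]
    (hA : ∀ r ∈ m, algebraMap R A r = 0) {F F' : Type*} [AddCommGroup F] [Module R F]
    [AddCommGroup F'] [Module R F'] (f : F →ₗ[R] F')
    (hf : LinearMap.range f ≤ m • (⊤ : Submodule R F')) : f.baseChange A = 0 := by
  have key : ∀ y ∈ m • (⊤ : Submodule R F'), (1 : A) ⊗ₜ[R] y = 0 := by
    intro y hy
    refine Submodule.smul_induction_on hy (fun r hr n _ => ?_) (fun a b ha hb => ?_)
    · rw [← TensorProduct.smul_tmul, Algebra.smul_def, hA r hr, zero_mul, TensorProduct.zero_tmul]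
    · rw [TensorProduct.tmul_add, ha, hb, add_zero]
  ext x
  simpa using key _ (hf ⟨x, rfl⟩)

/-- Lift each cover through the other to get `g : F → F'` and `h : F' → F`. Then `h ∘ g - id` maps
into `ker p`, so it vanishes after base change to `A`, and `g` becomes split injective there. No
Nakayama argument is involved, so `R` need not be local or graded. -/
lemma finrank_le_of_minimal_cover_of_algebra (A : Type*) [CommRing A] [Nontrivial A] [Algebra R A]
    (hA : ∀ r ∈ m, algebraMap R A r = 0) {F F' Q : Type*} [AddCommGroup F] [Module R F]
    [AddCommGroup F'] [Module R F'] [AddCommGroup Q] [Module R Q]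
    [Module.Free R F] [Module.Finite R F] [Module.Free R F'] [Module.Finite R F']
    (p : F →ₗ[R] Q) (p' : F' →ₗ[R] Q) (hp : Function.Surjective p)
    (hp' : Function.Surjective p') (hk : LinearMap.ker p ≤ m • (⊤ : Submodule R F)) :
    Module.finrank R F ≤ Module.finrank R F' := by
  have : Nontrivial R := (algebraMap R A).domain_nontrivial
  obtain ⟨g, hg⟩ := Module.projective_lifting_property p' p hp'
  obtain ⟨h, hh⟩ := Module.projective_lifting_property p p' hp
  have hz : (h ∘ₗ g - LinearMap.id).baseChange A = 0 := by
    refine LinearMap.baseChange_eq_zero_of_range_le A hA _ (le_trans ?_ hk)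
    rintro _ ⟨x, rfl⟩
    have h1 := LinearMap.congr_fun hg x
    have h2 := LinearMap.congr_fun hh (g x)
    simp only [LinearMap.comp_apply] at h1 h2
    simp [h1, h2]
  have hid : h.baseChange A ∘ₗ g.baseChange A = LinearMap.id := by
    rw [← LinearMap.baseChange_comp, ← sub_add_cancel (h ∘ₗ g) LinearMap.id,
      LinearMap.baseChange_add, hz, zero_add, LinearMap.baseChange_id]
  have hinj : Function.Injective (g.baseChange A) := by
    refine Function.LeftInverse.injective (g := h.baseChange A) fun x => ?_
    simpa using LinearMap.congr_fun hid x
  have := LinearMap.finrank_le_finrank_of_injective hinj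
  rwa [Module.finrank_baseChange, Module.finrank_baseChange] at this

lemma finrank_le_of_minimal_cover (hm : m ≠ ⊤) {F F' Q : Type*} [AddCommGroup F] [Module R F]
    [AddCommGroup F'] [Module R F'] [AddCommGroup Q] [Module R Q]
    [Module.Free R F] [Module.Finite R F] [Module.Free R F'] [Module.Finite R F']
    (p : F →ₗ[R] Q) (p' : F' →ₗ[R] Q) (hp : Function.Surjective p)
    (hp' : Function.Surjective p') (hk : LinearMap.ker p ≤ m • (⊤ : Submodule R F)) :
    Module.finrank R F ≤ Module.finrank R F' :=
  have : Nontrivial (R ⧸ m) := Ideal.Quotient.nontrivial_iff.2 hm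
  finrank_le_of_minimal_cover_of_algebra (R ⧸ m)
    (fun _ hr => Ideal.Quotient.eq_zero_iff_mem.2 hr) p p' hp hp' hk

lemma finrank_eq_of_minimal_cover (hm : m ≠ ⊤) {F F' Q : Type*} [AddCommGroup F] [Module R F]
    [AddCommGroup F'] [Module R F'] [AddCommGroup Q] [Module R Q]
    [Module.Free R F] [Module.Finite R F] [Module.Free R F'] [Module.Finite R F']
    (p : F →ₗ[R] Q) (p' : F' →ₗ[R] Q) (hp : Function.Surjective p)
    (hp' : Function.Surjective p') (hk : LinearMap.ker p ≤ m • (⊤ : Submodule R F))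
    (hk' : LinearMap.ker p' ≤ m • (⊤ : Submodule R F')) :
    Module.finrank R F = Module.finrank R F' :=
  le_antisymm (finrank_le_of_minimal_cover hm p p' hp hp' hk)
    (finrank_le_of_minimal_cover hm p' p hp' hp hk')

/-- Schanuel's lemma. -/
lemma exists_schanuel_equiv {F F' Q : Type*} [AddCommGroup F] [Module R F]
    [AddCommGroup F'] [Module R F'] [AddCommGroup Q] [Module R Q]
    [Module.Projective R F] [Module.Projective R F']
    (p : F →ₗ[R] Q) (p' : F' →ₗ[R] Q) (hp : Function.Surjective p)
    (hp' : Function.Surjective p') :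
    Nonempty ((LinearMap.ker p × F') ≃ₗ[R] (LinearMap.ker p' × F)) := by
  obtain ⟨g, hg⟩ := Module.projective_lifting_property p' p hp'
  obtain ⟨h, hh⟩ := Module.projective_lifting_property p p' hp
  have h1 : ∀ x, p' (g x) = p x := fun x => LinearMap.congr_fun hg x
  have h2 : ∀ x, p (h x) = p' x := fun x => LinearMap.congr_fun hh x
  refine ⟨{
    toFun := fun z => (⟨z.2 - g (z.1 + h z.2), by
      simp [h1, h2, LinearMap.mem_ker.1 z.1.2]⟩, z.1 + h z.2)
    invFun := fun z => (⟨z.2 - h (z.1 + g z.2), by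
      simp [h1, h2, LinearMap.mem_ker.1 z.1.2]⟩, z.1 + g z.2)
    map_add' := ?_
    map_smul' := ?_
    left_inv := ?_
    right_inv := ?_ }⟩
  · rintro ⟨⟨x, hx⟩, y⟩ ⟨⟨x', hx'⟩, y'⟩
    ext
    · simp; abel
    · simp; abel
  · rintro r ⟨⟨x, hx⟩, y⟩
    ext
    · simp [smul_sub]
    · simp
  · rintro ⟨⟨x, hx⟩, y⟩
    ext <;> simp
  · rintro ⟨⟨x, hx⟩, y⟩
    ext <;> simp

/-- Adjoining a free summand to a module and to its cover keeps the cover minimal. -/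
lemma ker_prodMap_id_le {F N P : Type*} [AddCommGroup F] [Module R F]
    [AddCommGroup N] [Module R N] [AddCommGroup P] [Module R P] (f : F →ₗ[R] N)
    (hf : LinearMap.ker f ≤ m • (⊤ : Submodule R F)) :
    LinearMap.ker (f.prodMap (LinearMap.id : P →ₗ[R] P)) ≤ m • (⊤ : Submodule R (F × P)) := by
  rintro ⟨x, y⟩ hxy
  simp only [LinearMap.mem_ker, LinearMap.prodMap_apply, LinearMap.id_apply, Prod.mk_eq_zero]
    at hxy
  obtain ⟨hx, rfl⟩ := hxy
  have h1 : LinearMap.inl R F P x ∈ (m • (⊤ : Submodule R F)).map (LinearMap.inl R F P) :=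
    ⟨x, hf hx, rfl⟩
  rw [Submodule.map_smul''] at h1
  exact Submodule.smul_mono le_rfl le_top h1

/-- The kernel of `f × id` is the kernel of `f`. -/
def kerProdMapIdEquiv {F N P : Type*} [AddCommGroup F] [Module R F]
    [AddCommGroup N] [Module R N] [AddCommGroup P] [Module R P] (f : F →ₗ[R] N) :
    LinearMap.ker f ≃ₗ[R] LinearMap.ker (f.prodMap (LinearMap.id : P →ₗ[R] P)) where
  toFun x := ⟨(x, 0), by simp⟩
  invFun z := ⟨z.1.1, by
    have := z.2
    rw [LinearMap.mem_ker, LinearMap.prodMap_apply, Prod.mk_eq_zero] at this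
    exact this.1⟩
  left_inv x := rfl
  right_inv z := by
    have := z.2
    rw [LinearMap.mem_ker, LinearMap.prodMap_apply, Prod.mk_eq_zero] at this
    ext
    · rfl
    · exact this.2.symm
  map_add' x y := by ext <;> simp
  map_smul' r x := by ext <;> simp

/-- Cuts a resolution at its first syzygy module, for induction along the resolution. -/
lemma HasMinimalResolution.exists_cover {N : Type*} [AddCommGroup N] [Module R N] {β : ℕ → ℕ}
    (h : HasMinimalResolution m N β) : ∃ ε : (Fin (β 0) → R) →ₗ[R] N,
      Function.Surjective ε ∧ LinearMap.ker ε ≤ m • (⊤ : Submodule R (Fin (β 0) → R)) ∧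
      HasMinimalResolution m (LinearMap.ker ε) (fun i => β (i + 1)) := by
  obtain ⟨d, ε, hε, h0, hd, hm⟩ := h
  have hr : LinearMap.ker ε = LinearMap.range (d 0) := LinearMap.exact_iff.1 h0
  refine ⟨ε, hε, hr.trans_le (hm 0), fun i => d (i + 1),
    (d 0).codRestrict (LinearMap.ker ε) fun x => hr ▸ ⟨x, rfl⟩, ?_, ?_, fun i => hd (i + 1),
    fun i => hm (i + 1)⟩
  · rintro ⟨x, hx⟩
    obtain ⟨y, hy⟩ := hr ▸ hx
    exact ⟨y, Subtype.ext hy⟩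
  · intro x
    rw [← hd 0 x, ← Subtype.coe_inj]
    rfl

/-- The free summands `P` and `P'` are carried along because Schanuel's lemma identifies syzygies
only up to free summands. -/
lemma HasMinimalResolution.rank_zero (hm : m ≠ ⊤) {N N' P P' : Type*} [AddCommGroup N]
    [Module R N] [AddCommGroup N'] [Module R N'] [AddCommGroup P] [Module R P] [AddCommGroup P']
    [Module R P'] [Module.Free R P] [Module.Finite R P] [Module.Free R P'] [Module.Finite R P']
    (e : (N × P) ≃ₗ[R] (N' × P')) {β β' : ℕ → ℕ} (h : HasMinimalResolution m N β)
    (h' : HasMinimalResolution m N' β') :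
    β 0 + Module.finrank R P = β' 0 + Module.finrank R P' := by
  have : Nontrivial (R ⧸ m) := Ideal.Quotient.nontrivial_iff.2 hm
  have : Nontrivial R := (Ideal.Quotient.mk m).domain_nontrivial
  obtain ⟨ε, hε, hk, -⟩ := h.exists_cover
  obtain ⟨ε', hε', hk', -⟩ := h'.exists_cover
  have := finrank_eq_of_minimal_cover hm (e.toLinearMap ∘ₗ ε.prodMap LinearMap.id)
    (ε'.prodMap LinearMap.id) (e.surjective.comp (hε.prodMap Function.surjective_id))
    (hε'.prodMap Function.surjective_id)
    (by rw [LinearEquiv.ker_comp]; exact ker_prodMap_id_le ε hk) (ker_prodMap_id_le ε' hk')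
  simpa using this

/-- Schanuel's lemma turns a stable isomorphism of modules into one of their first syzygies, which
`shifts` the index by one. From `β 1` on, the ranks of the free summands drop out. -/
lemma HasMinimalResolution.rank_succ (hm : m ≠ ⊤) (i : ℕ) : ∀ {N N' P P' : Type u}
    [AddCommGroup N] [Module R N] [AddCommGroup N'] [Module R N'] [AddCommGroup P] [Module R P]
    [AddCommGroup P'] [Module R P'] [Module.Free R P] [Module.Finite R P] [Module.Free R P']
    [Module.Finite R P'] (_ : (N × P) ≃ₗ[R] (N' × P')) {β β' : ℕ → ℕ}
    (_ : HasMinimalResolution m N β) (_ : HasMinimalResolution m N' β'),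
    β (i + 1) = β' (i + 1) := by
  have : Nontrivial (R ⧸ m) := Ideal.Quotient.nontrivial_iff.2 hm
  have : Nontrivial R := (Ideal.Quotient.mk m).domain_nontrivial
  induction i with
  | zero =>
    intro N N' P P' _ _ _ _ _ _ _ _ _ _ _ _ e β β' h h'
    have h0 := h.rank_zero hm e h'
    obtain ⟨ε, hε, -, hr⟩ := h.exists_cover
    obtain ⟨ε', hε', -, hr'⟩ := h'.exists_cover
    obtain ⟨s⟩ := exists_schanuel_equiv (e.toLinearMap ∘ₗ ε.prodMap LinearMap.id)
      (ε'.prodMap LinearMap.id) (e.surjective.comp (hε.prodMap Function.surjective_id))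
      (hε'.prodMap Function.surjective_id)
    -- The new free summands are `F₀' × P'` and `F₀ × P`; by `h0` they have equal rank, so the ranks
    -- `β 1` and `β' 1` agree.
    have h1 := hr.rank_zero hm (((kerProdMapIdEquiv ε).trans (LinearEquiv.ofEq _ _
      (LinearEquiv.ker_comp _ _).symm)).prodCongr (LinearEquiv.refl R _) ≪≫ₗ s ≪≫ₗ
        ((kerProdMapIdEquiv ε').symm.prodCongr (LinearEquiv.refl R _))) hr'
    simp at h1 ⊢
    omega
  | succ i ih =>
    intro N N' P P' _ _ _ _ _ _ _ _ _ _ _ _ e β β' h h'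
    obtain ⟨ε, hε, -, hr⟩ := h.exists_cover
    obtain ⟨ε', hε', -, hr'⟩ := h'.exists_cover
    obtain ⟨s⟩ := exists_schanuel_equiv (e.toLinearMap ∘ₗ ε.prodMap LinearMap.id)
      (ε'.prodMap LinearMap.id) (e.surjective.comp (hε.prodMap Function.surjective_id))
      (hε'.prodMap Function.surjective_id)
    exact ih (((kerProdMapIdEquiv ε).trans (LinearEquiv.ofEq _ _
      (LinearEquiv.ker_comp _ _).symm)).prodCongr (LinearEquiv.refl R _) ≪≫ₗ s ≪≫ₗ
        ((kerProdMapIdEquiv ε').symm.prodCongr (LinearEquiv.refl R _))) hr hr'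

/-- The Betti numbers of a minimal free resolution are unique. -/
theorem HasMinimalResolution.unique (hm : m ≠ ⊤) {N : Type u} [AddCommGroup N] [Module R N]
    {β β' : ℕ → ℕ} (h : HasMinimalResolution m N β) (h' : HasMinimalResolution m N β') :
    β = β' := by
  funext i
  cases i with
  -- The summand `R` on both sides is a dummy.
  | zero => simpa using h.rank_zero hm (LinearEquiv.refl R (N × R)) h'
  | succ i => exact h.rank_succ hm i (LinearEquiv.refl R (N × R)) h'

end MinimalResolution

/-! ### Mapping cones of matrices -/

section MappingCone

universe u

variable {R : Type u} [CommRing R] {m : Ideal R}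

/-- Choosing bases moves a resolution by arbitrary finite free modules onto the standard ones, so
the cone can be built from products. -/
lemma hasMinimalResolution_of_free [Nontrivial R] {N : Type*} [AddCommGroup N] [Module R N]
    {β : ℕ → ℕ} {F : ℕ → Type*} [∀ i, AddCommGroup (F i)] [∀ i, Module R (F i)]
    [∀ i, Module.Free R (F i)] [∀ i, Module.Finite R (F i)]
    (hβ : ∀ i, Module.finrank R (F i) = β i) (d : ∀ i, F (i + 1) →ₗ[R] F i) (ε : F 0 →ₗ[R] N)
    (hε : Function.Surjective ε) (h0 : Function.Exact (d 0) ε)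
    (hd : ∀ i, Function.Exact (d (i + 1)) (d i))
    (hm : ∀ i, LinearMap.range (d i) ≤ m • (⊤ : Submodule R (F i))) :
    HasMinimalResolution m N β := by
  let e : ∀ i, F i ≃ₗ[R] (Fin (β i) → R) := fun i =>
    (Module.finBasisOfFinrankEq R (F i) (hβ i)).equivFun
  refine ⟨fun i => (e i).toLinearMap ∘ₗ d i ∘ₗ (e (i + 1)).symm.toLinearMap,
    ε ∘ₗ (e 0).symm.toLinearMap, hε.comp (e 0).symm.surjective, ?_, fun i => ?_, fun i => ?_⟩
  · intro y
    simp only [LinearMap.comp_apply, LinearEquiv.coe_coe, h0 _, Set.mem_range]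
    constructor
    · rintro ⟨x, hx⟩
      exact ⟨e 1 x, by simp [hx]⟩
    · rintro ⟨x, hx⟩
      exact ⟨(e 1).symm x, by simp [← hx]⟩
  · intro y
    simp only [LinearMap.comp_apply, LinearEquiv.coe_coe, Set.mem_range,
      LinearEquiv.map_eq_zero_iff, hd i _]
    constructor
    · rintro ⟨x, hx⟩
      exact ⟨e _ x, by simp [hx]⟩
    · rintro ⟨x, hx⟩
      exact ⟨(e _).symm x, by simp [← hx]⟩
  · rintro _ ⟨x, rfl⟩
    have h1 := Submodule.mem_map_of_mem (f := (e i).toLinearMap)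
      (hm i ⟨(e (i + 1)).symm x, rfl⟩)
    rw [Submodule.map_smul''] at h1
    exact Submodule.smul_mono le_rfl le_top h1

lemma mem_smul_top_pi {ι : Type*} [Fintype ι] {M : Type*} [AddCommGroup M] [Module R M]
    {x : ι → M} (hx : ∀ i, x i ∈ m • (⊤ : Submodule R M)) :
    x ∈ m • (⊤ : Submodule R (ι → M)) := by
  classical
  rw [← Finset.univ_sum_single x]
  refine Submodule.sum_mem _ fun i _ => ?_
  have h1 := Submodule.mem_map_of_mem (f := LinearMap.single R (fun _ => M) i) (hx i)
  rw [Submodule.map_smul''] at h1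
  exact Submodule.smul_mono le_rfl le_top h1

lemma mk_mem_smul_top_prod {M M' : Type*} [AddCommGroup M] [Module R M] [AddCommGroup M']
    [Module R M'] {x : M} {y : M'} (hx : x ∈ m • (⊤ : Submodule R M))
    (hy : y ∈ m • (⊤ : Submodule R M')) : (x, y) ∈ m • (⊤ : Submodule R (M × M')) := by
  have h1 := Submodule.mem_map_of_mem (f := LinearMap.inl R M M') hx
  have h2 := Submodule.mem_map_of_mem (f := LinearMap.inr R M M') hy
  rw [Submodule.map_smul''] at h1 h2
  have := add_mem (Submodule.smul_mono le_rfl le_top h1) (Submodule.smul_mono le_rfl le_top h2)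
  simpa using this

/-- A matrix acts on columns with entries in any module. -/
def Matrix.columnMap {ι κ : Type*} [Fintype κ] (A : Matrix ι κ R) (M : Type*) [AddCommGroup M]
    [Module R M] : (κ → M) →ₗ[R] (ι → M) :=
  LinearMap.pi fun i => ∑ j, A i j • LinearMap.proj j

lemma Matrix.columnMap_apply {ι κ : Type*} [Fintype κ] (A : Matrix ι κ R) {M : Type*}
    [AddCommGroup M] [Module R M] (v : κ → M) (i : ι) :
    A.columnMap M v i = ∑ j, A i j • v j := by
  simp [Matrix.columnMap]

/-- Naturality: the same matrix acts on every term of a resolution as a chain map, so no lifting is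
needed to form the cone. -/
lemma Matrix.columnMap_compLeft {ι κ : Type*} [Fintype κ] (A : Matrix ι κ R) {M M' : Type*}
    [AddCommGroup M] [Module R M] [AddCommGroup M'] [Module R M'] (f : M →ₗ[R] M') (v : κ → M) :
    A.columnMap M' (f.compLeft κ v) = f.compLeft ι (A.columnMap M v) := by
  ext i
  simp [Matrix.columnMap_apply]

lemma Matrix.columnMap_mem {ι κ : Type*} [Fintype ι] [Fintype κ] (A : Matrix ι κ R)
    (hA : ∀ i j, A i j ∈ m) {M : Type*} [AddCommGroup M] [Module R M] (v : κ → M) :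
    A.columnMap M v ∈ m • (⊤ : Submodule R (ι → M)) := by
  refine mem_smul_top_pi fun i => ?_
  rw [Matrix.columnMap_apply]
  exact Submodule.sum_mem _ fun j _ => Submodule.smul_mem_smul (hA i j) trivial

lemma Function.Exact.compLeft {M M' M'' : Type*} [AddCommGroup M] [Module R M] [AddCommGroup M']
    [Module R M'] [AddCommGroup M''] [Module R M''] {f : M →ₗ[R] M'} {g : M' →ₗ[R] M''}
    (h : Function.Exact f g) (ι : Type*) : Function.Exact (f.compLeft ι) (g.compLeft ι) := by
  intro y
  constructor
  · intro hy
    choose x hx using fun i => (h (y i)).1 (congrFun hy i)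
    exact ⟨x, funext hx⟩
  · rintro ⟨x, rfl⟩
    ext i
    exact h.apply_apply_eq_zero (x i)

/-- The sequence `0, β 0, β 1, …`. -/
def shiftRight (β : ℕ → ℕ) : ℕ → ℕ
  | 0 => 0
  | i + 1 => β i

/-- The complex shifted by one place, starting with the zero module. -/
def shiftedDifferential {β : ℕ → ℕ} (d : ∀ i, (Fin (β (i + 1)) → R) →ₗ[R] (Fin (β i) → R)) :
    ∀ i, (Fin (β i) → R) →ₗ[R] (Fin (shiftRight β i) → R)
  | 0 => 0
  | i + 1 => d i

/-- The mapping cone of the action of a matrix `A` on a minimal resolution of `N` is a minimal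
resolution of the cokernel of `A`, if `A` acts injectively on `N` and has entries in `m`. -/
theorem HasMinimalResolution.cone [Nontrivial R] {N Q : Type*} [AddCommGroup N] [Module R N]
    [AddCommGroup Q] [Module R Q] {β : ℕ → ℕ} (h : HasMinimalResolution m N β)
    {ι κ : Type} [Fintype ι] [Fintype κ] (A : Matrix ι κ R) (hA : ∀ i j, A i j ∈ m)
    (π : (ι → N) →ₗ[R] Q) (hπ : Function.Surjective π)
    (hinj : Function.Injective (A.columnMap N)) (hex : Function.Exact (A.columnMap N) π) :
    HasMinimalResolution m Q
      (fun i => Fintype.card ι * β i + Fintype.card κ * shiftRight β i) := by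
  obtain ⟨d, ε, hε, h0, hd, hm⟩ := h
  have hs : ∀ i (w : κ → Fin (β (i + 1)) → R),
      (shiftedDifferential d i).compLeft κ ((d i).compLeft κ w) = 0 := by
    rintro (_ | i) w
    · rfl
    · exact ((hd i).compLeft κ).apply_apply_eq_zero w
  let D : ∀ i, ((ι → Fin (β (i + 1)) → R) × (κ → Fin (β i) → R)) →ₗ[R]
      ((ι → Fin (β i) → R) × (κ → Fin (shiftRight β i) → R)) := fun i =>
    ((d i).compLeft ι ∘ₗ LinearMap.fst R _ _ + A.columnMap _ ∘ₗ LinearMap.snd R _ _).prod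
      (-((shiftedDifferential d i).compLeft κ ∘ₗ LinearMap.snd R _ _))
  have hD : ∀ i u v, D i (u, v) = ((d i).compLeft ι u + A.columnMap _ v,
      -(shiftedDifferential d i).compLeft κ v) := fun i u v => rfl
  have hmem : ∀ i u v, D i (u, v) ∈ m • (⊤ : Submodule R
      ((ι → Fin (β i) → R) × (κ → Fin (shiftRight β i) → R))) := by
    intro i u v
    rw [hD]
    refine mk_mem_smul_top_prod (add_mem (mem_smul_top_pi fun a => hm i ⟨u a, rfl⟩)
      (A.columnMap_mem hA v)) (neg_mem (mem_smul_top_pi fun a => ?_))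
    cases i with
    | zero => exact Submodule.zero_mem _
    | succ i => exact hm i ⟨v a, rfl⟩
  have hexact : ∀ i u v, D i (u, v) = 0 ↔ ∃ z w,
      (d (i + 1)).compLeft ι z + A.columnMap _ w = u ∧ -(d i).compLeft κ w = v := by
    intro i u v
    rw [hD, Prod.mk_eq_zero, neg_eq_zero]
    constructor
    · rintro ⟨huv, hv⟩
      have hw : ∃ w, (d i).compLeft κ w = v := by
        cases i with
        -- In degree zero `v` is not yet known to be a cycle. Applying the augmentation to the first
        -- equation gives `A (ε v) = 0`, and injectivity of `A` on `N` gives `ε v = 0`.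
        | zero =>
          refine (h0.compLeft κ v).1 (hinj ?_)
          have h1 := congrArg (ε.compLeft ι) huv
          rwa [map_add, (h0.compLeft ι).apply_apply_eq_zero, zero_add,
            ← Matrix.columnMap_compLeft, map_zero, ← map_zero (A.columnMap N)] at h1
        | succ i => exact ((hd i).compLeft κ v).1 hv
      obtain ⟨w, rfl⟩ := hw
      -- With `v = d w`, the first equation reads `d (u + A w) = 0`, so `u + A w = d z`; the
      -- preimage is `(z, -w)` because of the sign in the cone.
      rw [Matrix.columnMap_compLeft, ← map_add, (hd i).compLeft ι _] at huv
      obtain ⟨z, hz⟩ := huv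
      exact ⟨z, -w, by rw [hz, map_neg, add_neg_cancel_right], by rw [map_neg, neg_neg]⟩
    · rintro ⟨z, w, rfl, rfl⟩
      rw [map_add, ((hd i).compLeft ι).apply_apply_eq_zero, zero_add, map_neg, map_neg, hs,
        Matrix.columnMap_compLeft, add_neg_cancel, neg_zero]
      exact ⟨rfl, rfl⟩
  have hcoker : ∀ u, π (ε.compLeft ι u) = 0 ↔ ∃ z w,
      (d 0).compLeft ι z + A.columnMap _ w = u := by
    intro u
    rw [hex _]
    constructor
    · rintro ⟨n, hn⟩
      choose w hw using fun i => hε (n i)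
      obtain rfl : ε.compLeft κ w = n := funext hw
      rw [Matrix.columnMap_compLeft, eq_comm, ← sub_eq_zero, ← map_sub, h0.compLeft ι _] at hn
      obtain ⟨z, hz⟩ := hn
      exact ⟨z, w, by rw [hz, sub_add_cancel]⟩
    · rintro ⟨z, w, rfl⟩
      exact ⟨ε.compLeft κ w, by rw [map_add, (h0.compLeft ι).apply_apply_eq_zero, zero_add,
        Matrix.columnMap_compLeft]⟩
  refine hasMinimalResolution_of_free
    (F := fun i => (ι → Fin (β i) → R) × (κ → Fin (shiftRight β i) → R)) (fun i => ?_)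
    D (π ∘ₗ ε.compLeft ι ∘ₗ LinearMap.fst R _ _) ?_ ?_ (fun i => ?_) (fun i => ?_)
  · simp [Module.finrank_prod, Module.finrank_pi_fintype]
  · intro q
    obtain ⟨n, rfl⟩ := hπ q
    choose u hu using fun i => hε (n i)
    exact ⟨(u, 0), congrArg π (funext hu)⟩
  · rintro ⟨u, v⟩
    refine (hcoker u).trans ⟨?_, ?_⟩
    · rintro ⟨z, w, h⟩
      exact ⟨(z, w), Prod.ext h (Subsingleton.elim (α := κ → Fin 0 → R) _ _)⟩
    · rintro ⟨⟨z, w⟩, h⟩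
      exact ⟨z, w, congrArg Prod.fst h⟩
  · rintro ⟨u, v⟩
    refine (hexact i u v).trans ⟨?_, ?_⟩
    · rintro ⟨z, w, h1, h2⟩
      exact ⟨(z, w), Prod.ext h1 h2⟩
    · rintro ⟨⟨z, w⟩, h⟩
      exact ⟨z, w, congrArg Prod.fst h, congrArg Prod.snd h⟩
  · rintro _ ⟨⟨u, v⟩, rfl⟩
    exact hmem i u v

end MappingCone

/-! ### Products with the ideal of all-but-one products -/

section ProductIdeal

universe u

variable {R : Type u} [CommRing R] {m : Ideal R}

/-- The matrix whose columns generate the relations between the products of all but one of the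
`x i`. -/
def relationMatrix {n : ℕ} (x : Fin (n + 1) → R) : Matrix (Fin (n + 1)) (Fin n) R := fun i j =>
  Fin.cases (-x 0) (fun a => if a = j then x a.succ else 0) i

lemma relationMatrix_columnMap_zero {n : ℕ} (x : Fin (n + 1) → R) {M : Type*} [AddCommGroup M]
    [Module R M] (v : Fin n → M) :
    (relationMatrix x).columnMap M v 0 = -(x 0 • ∑ j, v j) := by
  simp [Matrix.columnMap_apply, relationMatrix, Finset.smul_sum]

lemma relationMatrix_columnMap_succ {n : ℕ} (x : Fin (n + 1) → R) {M : Type*} [AddCommGroup M]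
    [Module R M] (v : Fin n → M) (j : Fin n) :
    (relationMatrix x).columnMap M v j.succ = x j.succ • v j := by
  simp [Matrix.columnMap_apply, relationMatrix, ite_smul]

/-- If the `x i` are pairwise non-associated primes that are regular modulo the ideal `I`, then
a minimal resolution of `I` gives one of the product of `I` and the ideal generated by the products
of all but one of the `x i`. -/
theorem HasMinimalResolution.mul_span_prod_erase [IsDomain R] {I : Ideal R} {β : ℕ → ℕ}
    (h : HasMinimalResolution m I β) {n : ℕ} (x : Fin (n + 1) → R) (hxm : ∀ i, x i ∈ m)
    (hx : ∀ i, Prime (x i)) (hxx : ∀ i j, i ≠ j → ¬ x i ∣ x j)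
    (hI : ∀ i p, x i * p ∈ I → p ∈ I) :
    HasMinimalResolution m
      ↥(I * Ideal.span (Set.range fun i => ∏ j ∈ Finset.univ.erase i, x j))
      (fun i => (n + 1) * β i + n * shiftRight β i) := by
  set P : Fin (n + 1) → R := fun i => ∏ j ∈ Finset.univ.erase i, x j with hP
  have hPx : ∀ i, P i * x i = ∏ j, x j := fun i => Finset.prod_erase_mul _ _ (Finset.mem_univ i)
  let π₀ : (Fin (n + 1) → I) →ₗ[R] R := ∑ i, P i • (Submodule.subtype I ∘ₗ LinearMap.proj i)
  have hπ₀ : ∀ y, π₀ y = ∑ i, P i * (y i : R) := fun y => by simp [π₀]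
  have hmem : ∀ y, π₀ y ∈ I * Ideal.span (Set.range P) := fun y => by
    rw [hπ₀]
    exact Submodule.sum_mem _ fun i _ => by
      rw [mul_comm (P i)]
      exact Ideal.mul_mem_mul (y i).2 (Ideal.subset_span ⟨i, rfl⟩)
  have hsurj : ∀ q ∈ I * Ideal.span (Set.range P), ∃ y, π₀ y = q := by
    intro q hq
    have hle : I * Ideal.span (Set.range P) ≤ LinearMap.range π₀ := by
      rw [Ideal.mul_le]
      intro r hr s hs
      induction hs using Submodule.span_induction with
      | mem s hs =>
        obtain ⟨i, rfl⟩ := hs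
        refine ⟨Pi.single i ⟨r, hr⟩, ?_⟩
        rw [hπ₀, Finset.sum_eq_single i]
        · simp [mul_comm]
        · intro j _ hj
          simp [Pi.single_eq_of_ne hj]
        · simp
      | zero => simp
      | add s t _ _ h1 h2 => rw [mul_add]; exact add_mem h1 h2
      | smul a s _ h1 =>
        rw [smul_eq_mul, mul_left_comm]
        exact Submodule.smul_mem _ a h1
    exact hle hq
  have := h.cone (relationMatrix x) (fun i j => ?_)
    (π₀.codRestrict (I * Ideal.span (Set.range P)) hmem) ?_ ?_ ?_
  · simpa using this
  · refine Fin.cases ?_ (fun a => ?_) i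
    · exact neg_mem (hxm 0)
    · simp only [relationMatrix, Fin.cases_succ]
      split_ifs
      · exact hxm _
      · exact zero_mem _
  · rintro ⟨q, hq⟩
    obtain ⟨y, hy⟩ := hsurj q hq
    exact ⟨y, Subtype.ext hy⟩
  · rw [injective_iff_map_eq_zero]
    intro v hv
    ext j
    have h1 := congrFun hv j.succ
    rw [relationMatrix_columnMap_succ] at h1
    have h2 := congrArg Subtype.val h1
    simpa [(hx j.succ).ne_zero] using h2
  · intro y
    have h0 : π₀.codRestrict (I * Ideal.span (Set.range P)) hmem y = 0 ↔ π₀ y = 0 :=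
      ⟨fun h => congrArg Subtype.val h, fun h => Subtype.ext h⟩
    rw [h0, hπ₀]
    constructor
    · intro hy
      -- Every `P j` with `j ≠ i` is divisible by `x i`, hence so is the remaining term `P i * y i`;
      -- but `x i` is prime and does not divide `P i`.
      have hdvd : ∀ i, x i ∣ (y i : R) := by
        intro i
        have h1 : x i ∣ P i * (y i : R) := by
          rw [← Finset.add_sum_erase _ _ (Finset.mem_univ i)] at hy
          rw [eq_neg_of_add_eq_zero_left hy, dvd_neg]
          refine Finset.dvd_sum fun j hj => Dvd.dvd.mul_right (Finset.dvd_prod_of_mem _ ?_) _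
          exact Finset.mem_erase.2 ⟨(Finset.ne_of_mem_erase hj).symm, Finset.mem_univ _⟩
        rcases (hx i).dvd_or_dvd h1 with h2 | h2
        · obtain ⟨j, hj, hij⟩ := (hx i).exists_mem_finset_dvd h2
          exact absurd hij (hxx i j (Finset.ne_of_mem_erase hj).symm)
        · exact h2
      choose c hc using hdvd
      have hcI : ∀ i, c i ∈ I := fun i => hI i _ (hc i ▸ (y i).2)
      -- Substituting `y i = x i * c i` turns the relation into `(∏ x j) * ∑ c i = 0`. So `c 0` is
      -- determined by the others, which are the coordinates of the preimage.
      have hsum : ∑ i, c i = 0 := by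
        have h1 : (∏ j, x j) * ∑ i, c i = 0 := by
          rw [Finset.mul_sum, ← hy]
          refine Finset.sum_congr rfl fun i _ => ?_
          rw [hc i, ← hPx i, mul_assoc]
        exact (mul_eq_zero.1 h1).resolve_left
          (Finset.prod_ne_zero_iff.2 fun i _ => (hx i).ne_zero)
      refine ⟨fun j => ⟨c j.succ, hcI _⟩, ?_⟩
      funext i
      refine Fin.cases ?_ (fun j => ?_) i
      · rw [relationMatrix_columnMap_zero]
        rw [Fin.sum_univ_succ] at hsum
        ext
        simp [hc 0, eq_neg_of_add_eq_zero_left hsum]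
      · rw [relationMatrix_columnMap_succ]
        ext
        simp [hc j.succ]
    · rintro ⟨v, rfl⟩
      rw [Fin.sum_univ_succ, relationMatrix_columnMap_zero]
      simp only [relationMatrix_columnMap_succ]
      simp only [NegMemClass.coe_neg, SetLike.val_smul, smul_eq_mul, AddSubmonoidClass.coe_finsetSum,
        mul_neg, ← mul_assoc, hPx, Finset.mul_sum, neg_add_cancel]

end ProductIdeal

/-! ### Monomial ideals in disjoint variables -/

section MonomialIdeal

open MvPolynomial

variable {σ k : Type*} [Field k]

/-- `I` is generated by monomials that do not involve the variable `e`. -/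
def AvoidsVariable (I : Ideal (MvPolynomial σ k)) (e : σ) : Prop :=
  ∃ S : Set (σ →₀ ℕ), I = Ideal.span ((fun s => monomial s (1 : k)) '' S) ∧ ∀ s ∈ S, s e = 0

/-- Membership in a monomial ideal is tested on each monomial, and a generator free of `X e` that
divides `X e * t` already divides `t`. This is the regularity required of the variables of a new
circuit. -/
lemma AvoidsVariable.mem_of_X_mul_mem {I : Ideal (MvPolynomial σ k)} {e : σ}
    (h : AvoidsVariable I e) {p : MvPolynomial σ k} (hp : X e * p ∈ I) : p ∈ I := by
  classical
  obtain ⟨S, rfl, hS⟩ := h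
  rw [mem_ideal_span_monomial_image] at hp ⊢
  intro t ht
  obtain ⟨s, hs, hle⟩ := hp (Finsupp.single e 1 + t) (by
    rw [support_X_mul]
    exact Finset.mem_map.2 ⟨t, ht, rfl⟩)
  refine ⟨s, hs, fun a => ?_⟩
  by_cases ha : a = e
  · rw [ha, hS s hs]
    exact Nat.zero_le _
  · simpa [Finsupp.single_apply, Ne.symm ha] using hle a

lemma AvoidsVariable.mul {I J : Ideal (MvPolynomial σ k)} {e : σ} (hI : AvoidsVariable I e)
    (hJ : AvoidsVariable J e) : AvoidsVariable (I * J) e := by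
  obtain ⟨S, rfl, hS⟩ := hI
  obtain ⟨T, rfl, hT⟩ := hJ
  refine ⟨Set.image2 (· + ·) S T, ?_, ?_⟩
  · rw [Ideal.span_mul_span']
    congr 1
    ext p
    simp only [Set.mem_mul, Set.mem_image, Set.mem_image2]
    constructor
    · rintro ⟨_, ⟨s, hs, rfl⟩, _, ⟨t, ht, rfl⟩, rfl⟩
      exact ⟨s + t, ⟨s, hs, t, ht, rfl⟩, by simp [monomial_mul]⟩
    · rintro ⟨_, ⟨s, hs, t, ht, rfl⟩, rfl⟩
      exact ⟨_, ⟨s, hs, rfl⟩, _, ⟨t, ht, rfl⟩, by simp [monomial_mul]⟩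
  · rintro _ ⟨s, hs, t, ht, rfl⟩
    simp [hS s hs, hT t ht]

lemma avoidsVariable_span_prod_X {ι : Type*} (s : Set ι) (T : ι → Finset σ) {e : σ}
    (he : ∀ a ∈ s, e ∉ T a) :
    AvoidsVariable (Ideal.span ((fun a => ∏ b ∈ T a, (X b : MvPolynomial σ k)) '' s)) e := by
  refine ⟨(fun a => ∑ b ∈ T a, Finsupp.single b 1) '' s, ?_, ?_⟩
  · rw [Set.image_image]
    simp only [monomial_sum_one]
    rfl
  · classical
    rintro _ ⟨a, ha, rfl⟩
    rw [Finsupp.finsetSum_apply]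
    refine Finset.sum_eq_zero fun b hb => ?_
    rw [Finsupp.single_apply, if_neg]
    rintro rfl
    exact he a ha hb

lemma span_range_X_ne_top :
    Ideal.span (Set.range (X : σ → MvPolynomial σ k)) ≠ ⊤ := by
  intro h
  have hle : Ideal.span (Set.range (X : σ → MvPolynomial σ k)) ≤
      RingHom.ker (constantCoeff : MvPolynomial σ k →+* k) := by
    rw [Ideal.span_le]
    rintro _ ⟨e, rfl⟩
    simp [RingHom.mem_ker]
  rw [h] at hle
  simpa using RingHom.mem_ker.1 (hle (Submodule.mem_top (x := 1)))

open Classical in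
/-- The ideal generated by the products of all but one of the variables in `C`. -/
noncomputable def circuitIdeal (k : Type*) [Field k] (C : Finset σ) : Ideal (MvPolynomial σ k) :=
  Ideal.span ((fun a => ∏ b ∈ C.erase a, X b) '' (C : Set σ))

lemma circuitIdeal_eq [DecidableEq σ] (C : Finset σ) :
    circuitIdeal k C = Ideal.span ((fun a => ∏ b ∈ C.erase a, X b) '' (C : Set σ)) := by
  rw [circuitIdeal]
  congr!

lemma avoidsVariable_circuitIdeal {C : Finset σ} {e : σ} (he : e ∉ C) :
    AvoidsVariable (circuitIdeal k C) e := by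
  classical
  rw [circuitIdeal]
  exact avoidsVariable_span_prod_X _ _ fun a _ hea => he (Finset.mem_of_mem_erase hea)

/-- The generating function of the Betti numbers belonging to disjoint circuits of sizes
`f C`. -/
noncomputable def circuitBettiPoly {α : Type*} (𝒞 : Finset α) (f : α → ℕ) : Polynomial ℕ :=
  ∏ C ∈ 𝒞, (Polynomial.C (f C) + Polynomial.C (f C - 1) * Polynomial.X)

/-- A nonzero principal ideal of a domain is free of rank one; this starts the induction over the
circuits. -/
lemma hasMinimalResolution_span_singleton {R : Type*} [CommRing R] [IsDomain R] (m : Ideal R)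
    {p : R} (hp : p ≠ 0) :
    HasMinimalResolution m (Ideal.span {p}) (fun i => (1 : Polynomial ℕ).coeff i) := by
  have hsub : ∀ i, Subsingleton (Fin ((1 : Polynomial ℕ).coeff (i + 1)) → R) := by
    intro i
    rw [Polynomial.coeff_one, if_neg (Nat.succ_ne_zero i)]
    infer_instance
  have h0 : (1 : Polynomial ℕ).coeff 0 = 1 := Polynomial.coeff_one_zero
  let e : (Fin ((1 : Polynomial ℕ).coeff 0) → R) ≃ₗ[R] Ideal.span {p} :=
    LinearEquiv.funCongrLeft R R (finCongr h0.symm) ≪≫ₗ LinearEquiv.funUnique (Fin 1) R R ≪≫ₗ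
      LinearEquiv.toSpanNonzeroSingleton R R p hp
  refine ⟨fun _ => 0, e.toLinearMap, e.surjective, fun x => ?_, fun i x => ?_, fun i => by simp⟩
  · have hx : e.toLinearMap x = 0 ↔ x = 0 := e.map_eq_zero_iff
    rw [hx]
    simp [eq_comm]
  · have := hsub i
    simp [Subsingleton.elim x 0]

lemma HasMinimalResolution.mul_circuitIdeal {σ k : Type*} [Field k] {I : Ideal (MvPolynomial σ k)}
    {P : Polynomial ℕ}
    (h : HasMinimalResolution (Ideal.span (Set.range (X : σ → MvPolynomial σ k))) I P.coeff)
    {C : Finset σ} (hC : C.Nonempty) (hI : ∀ e ∈ C, AvoidsVariable I e) :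
    HasMinimalResolution (Ideal.span (Set.range (X : σ → MvPolynomial σ k)))
      ↥(I * circuitIdeal k C)
      (P * (Polynomial.C C.card + Polynomial.C (C.card - 1) * Polynomial.X)).coeff := by
  classical
  obtain ⟨n, hn⟩ : ∃ n, C.card = n + 1 := Nat.exists_eq_succ_of_ne_zero hC.card_pos.ne'
  let f : Fin (n + 1) ≃ C := (C.equivFinOfCardEq hn).symm
  have hinj : Function.Injective fun i => (f i : σ) := Subtype.val_injective.comp f.injective
  have himage : ∀ i, (C.erase (f i)) = (Finset.univ.erase i).image fun j => (f j : σ) := by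
    intro i
    ext a
    simp only [Finset.mem_erase, Finset.mem_image, Finset.mem_univ, and_true]
    constructor
    · rintro ⟨h1, h2⟩
      refine ⟨f.symm ⟨a, h2⟩, ?_, by simp⟩
      rintro rfl
      simp at h1
    · rintro ⟨j, hj, rfl⟩
      exact ⟨fun h => hj (hinj h), (f j).2⟩
  have key := h.mul_span_prod_erase (fun i => X (f i : σ)) (fun i => Ideal.subset_span ⟨_, rfl⟩)
    (fun i => X_prime) (fun i j hij hd => hij (hinj (X_dvd_X.1 hd)))
    (fun i p hp => (hI _ (f i).2).mem_of_X_mul_mem hp)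
  have hJ : Ideal.span (Set.range fun i => ∏ j ∈ Finset.univ.erase i,
      (X (f j : σ) : MvPolynomial σ k)) = circuitIdeal k C := by
    rw [circuitIdeal]
    congr 1
    ext p
    simp only [Set.mem_range, Set.mem_image, Finset.mem_coe]
    have hprod : ∀ i, ∏ b ∈ C.erase (f i), (X b : MvPolynomial σ k) =
        ∏ j ∈ Finset.univ.erase i, X (f j : σ) := by
      intro i
      rw [himage, Finset.prod_image fun a _ b _ hab => hinj hab]
    constructor
    · rintro ⟨i, rfl⟩
      exact ⟨f i, (f i).2, hprod i⟩
    · rintro ⟨a, ha, rfl⟩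
      refine ⟨f.symm ⟨a, ha⟩, ?_⟩
      rw [← hprod, Equiv.apply_symm_apply]
  have hβ : (fun i => (n + 1) * P.coeff i + n * shiftRight P.coeff i) =
      (P * (Polynomial.C C.card + Polynomial.C (C.card - 1) * Polynomial.X)).coeff := by
    funext i
    rw [hn, Nat.add_sub_cancel, mul_add, Polynomial.coeff_add, Polynomial.coeff_mul_C,
      ← mul_assoc]
    cases i with
    | zero => simp [shiftRight, mul_comm]
    | succ i =>
      rw [Polynomial.coeff_mul_X, Polynomial.coeff_mul_C, shiftRight, mul_comm (n + 1),
        mul_comm n]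
  rwa [hJ, hβ] at key

/-- The minimal resolution of the product of a squarefree monomial with the ideals of disjoint
circuits. -/
theorem hasMinimalResolution_prod_circuitIdeal {σ k : Type*} [Field k] (B : Finset σ)
    (𝒞 : Finset (Finset σ)) (hne : ∀ C ∈ 𝒞, C.Nonempty)
    (hdisj : (𝒞 : Set (Finset σ)).PairwiseDisjoint id) (hB : ∀ C ∈ 𝒞, Disjoint C B) :
    HasMinimalResolution (Ideal.span (Set.range (X : σ → MvPolynomial σ k)))
      ↥(Ideal.span {∏ e ∈ B, (X e : MvPolynomial σ k)} * ∏ C ∈ 𝒞, circuitIdeal k C)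
      (circuitBettiPoly 𝒞 Finset.card).coeff := by
  classical
  -- The induction also records that the partial product avoids every unused variable, which is what
  -- the next circuit needs.
  suffices H : ∀ 𝒟 ⊆ 𝒞, HasMinimalResolution (Ideal.span (Set.range (X : σ → MvPolynomial σ k)))
      ↥(Ideal.span {∏ e ∈ B, (X e : MvPolynomial σ k)} * ∏ C ∈ 𝒟, circuitIdeal k C)
      (circuitBettiPoly 𝒟 Finset.card).coeff ∧
      ∀ e, e ∉ B → (∀ C ∈ 𝒟, e ∉ C) → AvoidsVariable
        (Ideal.span {∏ e ∈ B, (X e : MvPolynomial σ k)} * ∏ C ∈ 𝒟, circuitIdeal k C) e from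
    (H 𝒞 subset_rfl).1
  intro 𝒟
  induction 𝒟 using Finset.induction_on with
  | empty =>
    intro _
    rw [Finset.prod_empty, mul_one, circuitBettiPoly, Finset.prod_empty]
    refine ⟨hasMinimalResolution_span_singleton _
      (Finset.prod_ne_zero_iff.2 fun e _ => X_ne_zero e), fun e he _ => ?_⟩
    have := avoidsVariable_span_prod_X (k := k) {()} (fun _ => B) fun _ _ => he
    rwa [Set.image_singleton] at this
  | insert C 𝒟 hC ih =>
    intro hsub
    obtain ⟨h1, h2⟩ := ih ((Finset.subset_insert _ _).trans hsub)
    have hC𝒞 := hsub (Finset.mem_insert_self C 𝒟)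
    have hP : circuitBettiPoly (insert C 𝒟) Finset.card = circuitBettiPoly 𝒟 Finset.card *
        (Polynomial.C C.card + Polynomial.C (C.card - 1) * Polynomial.X) := by
      rw [circuitBettiPoly, Finset.prod_insert hC, mul_comm]
      rfl
    rw [Finset.prod_insert hC, mul_comm (circuitIdeal k C), ← mul_assoc, hP]
    refine ⟨h1.mul_circuitIdeal (hne C hC𝒞) fun e he => h2 e ?_ ?_, fun e heB he => ?_⟩
    · exact Finset.disjoint_left.1 (hB C hC𝒞) he
    · intro D hD heD
      have hCD : C ≠ D := by
        rintro rfl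
        exact hC hD
      exact Finset.disjoint_left.1
        (hdisj hC𝒞 (hsub (Finset.mem_insert_of_mem hD)) hCD) he heD
    · exact (h2 e heB fun D hD => he D (Finset.mem_insert_of_mem hD)).mul
        (avoidsVariable_circuitIdeal (he C (Finset.mem_insert_self C 𝒟)))

end MonomialIdeal

/-! ### Minimal weights, size multisets and Betti polynomials -/

section MinWeight

/-- The least total weight of `i` elements of `𝒞`. -/
noncomputable def minWeight {α : Type*} (𝒞 : Finset α) (f : α → ℕ) (i : ℕ) : ℕ∞ :=
  sInf {m | ∃ 𝒟 ⊆ 𝒞, 𝒟.card = i ∧ m = ((∑ C ∈ 𝒟, f C : ℕ) : ℕ∞)}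

/-- The weights thus detect the number of elements of `𝒞`. -/
lemma minWeight_ne_top_iff {α : Type*} (𝒞 : Finset α) (f : α → ℕ) (i : ℕ) :
    minWeight 𝒞 f i ≠ ⊤ ↔ i ≤ 𝒞.card := by
  rw [minWeight, Ne, sInf_eq_top]
  constructor
  · intro h
    by_contra hlt
    refine h ?_
    rintro _ ⟨𝒟, h𝒟, rfl, rfl⟩
    exact absurd (Finset.card_le_card h𝒟) hlt
  · intro h h'
    obtain ⟨𝒟, h𝒟, hi⟩ := Finset.exists_subset_card_eq h
    exact ENat.natCast_ne_top _ (h' _ ⟨𝒟, h𝒟, hi, rfl⟩)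

/-- An exchange argument: an optimal family may be assumed to contain a lightest element, since any
other member can be traded for it. -/
lemma minWeight_succ {α : Type*} [DecidableEq α] {𝒞 : Finset α} {f : α → ℕ} {a : α} (ha : a ∈ 𝒞)
    (hmin : ∀ b ∈ 𝒞, f a ≤ f b) (i : ℕ) :
    minWeight 𝒞 f (i + 1) = minWeight (𝒞.erase a) f i + f a := by
  apply le_antisymm
  · rw [minWeight, minWeight, ENat.sInf_add]
    refine le_iInf₂ ?_
    rintro _ ⟨𝒟, h𝒟, rfl, rfl⟩
    have ha𝒟 : a ∉ 𝒟 := fun h => Finset.notMem_erase a 𝒞 (h𝒟 h)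
    refine sInf_le ⟨insert a 𝒟, Finset.insert_subset ha (h𝒟.trans (Finset.erase_subset _ _)),
      Finset.card_insert_of_notMem ha𝒟, ?_⟩
    rw [Finset.sum_insert ha𝒟, add_comm, Nat.cast_add]
  · refine le_sInf ?_
    rintro _ ⟨𝒟, h𝒟, hi, rfl⟩
    -- Discard `a` itself if it is present and any member otherwise, so that `𝒟.erase b` avoids `a`.
    obtain ⟨b, hb, hab⟩ : ∃ b ∈ 𝒟, a ∈ 𝒟 → b = a := by
      by_cases h : a ∈ 𝒟
      · exact ⟨a, h, fun _ => rfl⟩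
      · obtain ⟨b, hb⟩ : 𝒟.Nonempty := Finset.card_pos.1 (by omega)
        exact ⟨b, hb, fun h' => absurd h' h⟩
    rw [← Finset.sum_erase_add _ _ hb, Nat.cast_add]
    refine add_le_add (sInf_le ⟨𝒟.erase b, fun c hc => ?_, ?_, rfl⟩)
      (Nat.cast_le.2 (hmin b (h𝒟 hb)))
    · refine Finset.mem_erase.2 ⟨?_, h𝒟 (Finset.mem_of_mem_erase hc)⟩
      rintro rfl
      exact Finset.ne_of_mem_erase hc (hab (Finset.mem_of_mem_erase hc)).symm
    · rw [Finset.card_erase_of_mem hb]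
      omega

lemma minWeight_zero {α : Type*} (𝒞 : Finset α) (f : α → ℕ) : minWeight 𝒞 f 0 = 0 :=
  nonpos_iff_eq_zero.1 (sInf_le ⟨∅, Finset.empty_subset _, rfl, by simp⟩)

lemma minWeight_empty_succ {α : Type*} (f : α → ℕ) (i : ℕ) :
    minWeight ∅ f (i + 1) = ⊤ := by
  simpa using (minWeight_ne_top_iff ∅ f (i + 1)).not

/-- `minWeight` at `1` is the smallest value of `f`; remove an element attaining it on each side and
induct. -/
lemma map_eq_of_minWeight_eq (n : ℕ) : ∀ {α α' : Type*} (𝒞 : Finset α) (f : α → ℕ)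
    (𝒞' : Finset α') (f' : α' → ℕ), 𝒞.card = n → (∀ i, minWeight 𝒞 f i = minWeight 𝒞' f' i) →
    𝒞.val.map f = 𝒞'.val.map f' := by
  classical
  induction n with
  | zero =>
    intro α α' 𝒞 f 𝒞' f' hn h
    have h0 : 𝒞'.card = 0 := by
      by_contra hne
      have h1 := (minWeight_ne_top_iff 𝒞' f' 1).2 (Nat.pos_of_ne_zero hne)
      rw [← h, minWeight_ne_top_iff] at h1
      omega
    rw [Finset.card_eq_zero] at hn h0
    simp [hn, h0]
  | succ n ih =>
    intro α α' 𝒞 f 𝒞' f' hn h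
    have hne : 𝒞.Nonempty := Finset.card_pos.1 (by omega)
    have hne' : 𝒞'.Nonempty := by
      have h1 := (minWeight_ne_top_iff 𝒞 f 1).2 (by omega)
      rw [h, minWeight_ne_top_iff] at h1
      exact Finset.card_pos.1 h1
    obtain ⟨a, ha, hmin⟩ := Finset.exists_min_image 𝒞 f hne
    obtain ⟨a', ha', hmin'⟩ := Finset.exists_min_image 𝒞' f' hne'
    have haa : f a = f' a' := by
      have h1 := h 1
      rw [minWeight_succ ha hmin, minWeight_succ ha' hmin', minWeight_zero, minWeight_zero,
        zero_add, zero_add] at h1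
      exact_mod_cast h1
    have h2 := ih (𝒞.erase a) f (𝒞'.erase a') f'
      (by rw [Finset.card_erase_of_mem ha]; omega) fun i => by
        have h1 := h (i + 1)
        rw [minWeight_succ ha hmin, minWeight_succ ha' hmin', haa] at h1
        exact (WithTop.add_right_inj (ENat.natCast_ne_top (f' a'))).1 h1
    rw [← Finset.insert_erase ha, ← Finset.insert_erase ha',
      Finset.insert_val_of_notMem (Finset.notMem_erase _ _),
      Finset.insert_val_of_notMem (Finset.notMem_erase _ _), Multiset.map_cons, Multiset.map_cons,
      h2, haa]

lemma minWeight_eq_of_map_eq {α α' : Type*} {𝒞 : Finset α} {f : α → ℕ}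
    {𝒞' : Finset α'} {f' : α' → ℕ} (h : 𝒞.val.map f = 𝒞'.val.map f') (i : ℕ) :
    minWeight 𝒞 f i = minWeight 𝒞' f' i := by
  classical
  induction i generalizing 𝒞 𝒞' with
  | zero => rw [minWeight_zero, minWeight_zero]
  | succ i ih =>
    rcases 𝒞.eq_empty_or_nonempty with rfl | hne
    · obtain rfl : 𝒞' = ∅ := by simpa [eq_comm] using h
      rw [minWeight_empty_succ, minWeight_empty_succ]
    · have hne' : 𝒞'.Nonempty := by
        rw [Finset.nonempty_iff_ne_empty] at hne ⊢
        rintro rfl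
        exact hne (by simpa using h)
      obtain ⟨a, ha, hmin⟩ := Finset.exists_min_image 𝒞 f hne
      obtain ⟨a', ha', hmin'⟩ := Finset.exists_min_image 𝒞' f' hne'
      have haa : f a = f' a' := by
        apply le_antisymm
        · have : f' a' ∈ 𝒞.val.map f := h ▸ Multiset.mem_map_of_mem f' ha'
          obtain ⟨b, hb, hb'⟩ := Multiset.mem_map.1 this
          exact hb' ▸ hmin b hb
        · have : f a ∈ 𝒞'.val.map f' := h ▸ Multiset.mem_map_of_mem f ha
          obtain ⟨b, hb, hb'⟩ := Multiset.mem_map.1 this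
          exact hb' ▸ hmin' b hb
      rw [minWeight_succ ha hmin, minWeight_succ ha' hmin', haa]
      congr 1
      refine ih ?_
      rw [← Finset.insert_erase ha, ← Finset.insert_erase ha',
        Finset.insert_val_of_notMem (Finset.notMem_erase _ _),
        Finset.insert_val_of_notMem (Finset.notMem_erase _ _), Multiset.map_cons,
        Multiset.map_cons, haa] at h
      exact (Multiset.cons_inj_right _).1 h

lemma circuitBettiPoly_eq_prod_map {α : Type*} (𝒞 : Finset α) (f : α → ℕ) :
    circuitBettiPoly 𝒞 f = ((𝒞.val.map f).map fun n =>
      Polynomial.C n + Polynomial.C (n - 1) * Polynomial.X).prod := by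
  rw [Multiset.map_map]
  rfl

lemma circuitBettiPoly_eq_of_map_eq {α α' : Type*} {𝒞 : Finset α} {f : α → ℕ}
    {𝒞' : Finset α'} {f' : α' → ℕ} (h : 𝒞.val.map f = 𝒞'.val.map f') :
    circuitBettiPoly 𝒞 f = circuitBettiPoly 𝒞' f' := by
  rw [circuitBettiPoly_eq_prod_map, circuitBettiPoly_eq_prod_map, h]

/-- The roots of the Betti polynomial determine the circuit sizes, if these are at least two. -/
lemma roots_circuitBettiPoly {α : Type*} (𝒞 : Finset α) (f : α → ℕ) (hf : ∀ C ∈ 𝒞, 2 ≤ f C) :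
    ((circuitBettiPoly 𝒞 f).map (Nat.castRingHom ℚ)).roots.map
      (fun r => (r / (r + 1))) = 𝒞.val.map fun C => (f C : ℚ) := by
  classical
  -- For `n ≥ 2` the factor `n + (n - 1) X` is truly linear with root `r = -n / (n - 1)`. Then `r +
  -- 1 = -1 / (n - 1)`, so `r / (r + 1) = n`.
  have hne : ∀ C ∈ 𝒞, ((f C - 1 : ℕ) : ℚ) ≠ 0 := fun C hC => by
    have := hf C hC
    exact_mod_cast (by omega : f C - 1 ≠ 0)
  have hroots : ∀ C ∈ 𝒞, (((Polynomial.C (f C) + Polynomial.C (f C - 1) * Polynomial.X).map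
      (Nat.castRingHom ℚ))).roots = {-(((f C - 1 : ℕ) : ℚ)⁻¹ * (f C : ℚ))} := fun C hC => by
    rw [← Polynomial.roots_C_mul_X_add_C _ (hne C hC), add_comm]
    simp
  have hne0 : ∀ C ∈ 𝒞, ((Polynomial.C (f C) + Polynomial.C (f C - 1) * Polynomial.X).map
      (Nat.castRingHom ℚ)) ≠ 0 := fun C hC h => by
    have := hroots C hC
    rw [h, Polynomial.roots_zero] at this
    exact absurd this.symm (Multiset.singleton_ne_zero _)
  rw [circuitBettiPoly, Polynomial.map_prod, Polynomial.roots_prod _ _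
    (Finset.prod_ne_zero_iff.2 hne0)]
  rw [Multiset.bind_congr hroots, Multiset.bind_singleton, Multiset.map_map]
  refine Multiset.map_congr rfl fun C hC => ?_
  have h1 := hne C hC
  have h2 : ((f C - 1 : ℕ) : ℚ) = f C - 1 := by
    rw [Nat.cast_sub (by have := hf C hC; omega), Nat.cast_one]
  rw [h2] at h1
  simp only [Function.comp_apply, h2]
  have h3 : -(((f C : ℚ) - 1)⁻¹ * f C) + 1 = -((f C : ℚ) - 1)⁻¹ := by
    field_simp
    ring
  rw [h3]
  field_simp

lemma map_eq_of_circuitBettiPoly_eq {α α' : Type*} {𝒞 : Finset α} {f : α → ℕ}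
    {𝒞' : Finset α'} {f' : α' → ℕ} (hf : ∀ C ∈ 𝒞, 2 ≤ f C) (hf' : ∀ C ∈ 𝒞', 2 ≤ f' C)
    (h : circuitBettiPoly 𝒞 f = circuitBettiPoly 𝒞' f') : 𝒞.val.map f = 𝒞'.val.map f' := by
  apply Multiset.map_injective (Nat.cast_injective (R := ℚ))
  rw [Multiset.map_map, Multiset.map_map]
  exact (roots_circuitBettiPoly 𝒞 f hf).symm.trans (h ▸ roots_circuitBettiPoly 𝒞' f' hf')

end MinWeight

/-! ### Matroids with disjoint circuits -/

section DisjointCircuits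

open MvPolynomial

/-- `𝒞` is the set of circuits of the matroid `M`, and these are pairwise disjoint. -/
structure HasDisjointCircuits {α : Type*} (M : Matroid α) (𝒞 : Finset (Finset M.E)) : Prop where
  nonempty : ∀ C ∈ 𝒞, C.Nonempty
  disjoint : (𝒞 : Set (Finset M.E)).PairwiseDisjoint id
  indep_iff : ∀ s : Finset M.E, M.Indep (Subtype.val '' (s : Set M.E)) ↔ ∀ C ∈ 𝒞, ¬ C ⊆ s

namespace HasDisjointCircuits

variable {α : Type*} {M : Matroid α} {𝒞 : Finset (Finset M.E)}

lemma eq_of_mem (h : HasDisjointCircuits M 𝒞) {C D : Finset M.E} (hC : C ∈ 𝒞) (hD : D ∈ 𝒞)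
    {a : M.E} (haC : a ∈ C) (haD : a ∈ D) : C = D := by
  by_contra hne
  exact Finset.disjoint_left.1 (h.disjoint hC hD hne) haC haD

lemma exists_choice (h : HasDisjointCircuits M 𝒞) : ∃ g : 𝒞 → M.E, ∀ C, g C ∈ C.1 :=
  ⟨fun C => (h.nonempty C C.2).choose, fun C => (h.nonempty C C.2).choose_spec⟩

lemma injective_choice (h : HasDisjointCircuits M 𝒞) {g : 𝒞 → M.E} (hg : ∀ C, g C ∈ C.1) :
    Function.Injective g := fun C D hCD =>
  Subtype.ext (h.eq_of_mem C.2 D.2 (hg C) (hCD ▸ hg D))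

-- The deleted points hit every circuit inside `τ`. By disjointness only one point of each is
-- deleted, so putting `g C` back completes `C`.
open Classical in
lemma isBasis_sdiff_image (h : HasDisjointCircuits M 𝒞) {g : 𝒞 → M.E} (hg : ∀ C, g C ∈ C.1)
    (τ : Finset M.E) :
    M.IsBasis (Subtype.val '' ((τ \ (Finset.univ.filter (·.1 ⊆ τ)).image g : Finset M.E) :
      Set M.E)) (Subtype.val '' (τ : Set M.E)) := by
  refine Matroid.Indep.isBasis_of_forall_insert ((h.indep_iff _).2 fun C hC hsub => ?_)
    (Set.image_mono (Finset.coe_subset.2 Finset.sdiff_subset)) ?_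
  · refine (Finset.mem_sdiff.1 (hsub (hg ⟨C, hC⟩))).2 (Finset.mem_image_of_mem g ?_)
    exact Finset.mem_filter.2 ⟨Finset.mem_univ _, hsub.trans Finset.sdiff_subset⟩
  · rintro _ ⟨⟨a, ha, rfl⟩, hnot⟩
    have hai : a ∈ (Finset.univ.filter (·.1 ⊆ τ)).image g := by
      by_contra hai
      exact hnot ⟨a, Finset.mem_sdiff.2 ⟨ha, hai⟩, rfl⟩
    obtain ⟨C, hC, rfl⟩ := Finset.mem_image.1 hai
    obtain ⟨-, hCτ⟩ := Finset.mem_filter.1 hC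
    rw [← Set.image_insert_eq, ← Finset.coe_insert]
    refine ⟨fun hind => (h.indep_iff _).1 hind C C.2 fun b hb => ?_, by
      rintro _ ⟨b, -, rfl⟩
      exact b.2⟩
    by_cases hbC : b = g C
    · exact Finset.mem_insert.2 (Or.inl hbC)
    · refine Finset.mem_insert_of_mem (Finset.mem_sdiff.2 ⟨hCτ hb, fun hbi => ?_⟩)
      obtain ⟨D, -, rfl⟩ := Finset.mem_image.1 hbi
      exact hbC (congrArg g (Subtype.ext (h.eq_of_mem C.2 D.2 hb (hg D)))).symm

-- The basis of `τ` above omits one point for each circuit contained in `τ`, and these points are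
-- distinct.
open Classical in
lemma encard_eq_eRk_add (h : HasDisjointCircuits M 𝒞) (τ : Finset M.E) :
    (τ.card : ℕ∞) = M.eRk (Subtype.val '' (τ : Set M.E)) + (𝒞.filter (· ⊆ τ)).card := by
  obtain ⟨g, hg⟩ := h.exists_choice
  have hsub : (Finset.univ.filter (·.1 ⊆ τ)).image g ⊆ τ := by
    intro a ha
    obtain ⟨C, hC, rfl⟩ := Finset.mem_image.1 ha
    exact (Finset.mem_filter.1 hC).2 (hg C)
  have hcard : ((Finset.univ.filter (·.1 ⊆ τ)).image g).card = (𝒞.filter (· ⊆ τ)).card := by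
    rw [Finset.card_image_of_injective _ (h.injective_choice hg),
      ← Finset.card_map (Function.Embedding.subtype _)]
    congr 1
    ext C
    simp [and_comm]
  rw [← (h.isBasis_sdiff_image hg τ).encard_eq_eRk,
    Subtype.val_injective.encard_image, Set.encard_coe_eq_coe_finsetCard, ← Nat.cast_add,
    ← hcard, Finset.card_sdiff_add_card_eq_card hsub]

/-- The higher weights of a matroid with disjoint circuits. -/
lemma higherWeight_eq [Finite M.E] (h : HasDisjointCircuits M 𝒞) (i : ℕ) :
    M.higherWeight i = minWeight 𝒞 Finset.card i := by
  classical
  apply le_antisymm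
  · refine le_sInf ?_
    rintro _ ⟨𝒟, h𝒟, rfl, rfl⟩
    -- A circuit inside the union of `𝒟` meets, hence equals, a member of `𝒟`; so this union has
    -- nullity exactly `𝒟.card`.
    have hfilter : 𝒞.filter (· ⊆ 𝒟.biUnion id) = 𝒟 := by
      ext C
      rw [Finset.mem_filter]
      constructor
      · rintro ⟨hC, hsub⟩
        obtain ⟨a, ha⟩ := h.nonempty C hC
        obtain ⟨D, hD, haD⟩ := Finset.mem_biUnion.1 (hsub ha)
        exact h.eq_of_mem hC (h𝒟 hD) ha haD ▸ hD
      · exact fun hC => ⟨h𝒟 hC, Finset.subset_biUnion_of_mem id hC⟩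
    have hcard : (𝒟.biUnion id).card = ∑ C ∈ 𝒟, C.card :=
      Finset.card_biUnion fun C hC D hD hne => h.disjoint (h𝒟 hC) (h𝒟 hD) hne
    refine sInf_le ⟨Subtype.val '' ((𝒟.biUnion id : Finset M.E) : Set M.E), ?_, ?_, ?_⟩
    · rintro _ ⟨b, -, rfl⟩
      exact b.2
    · rw [Subtype.val_injective.encard_image, Set.encard_coe_eq_coe_finsetCard,
        h.encard_eq_eRk_add, hfilter]
    · rw [Subtype.val_injective.encard_image, Set.encard_coe_eq_coe_finsetCard, hcard]
  · refine le_sInf ?_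
    rintro _ ⟨τ, hτ, hi, rfl⟩
    have := Fintype.ofFinite M.E
    obtain ⟨τ, rfl⟩ : ∃ s : Finset M.E, Subtype.val '' (s : Set M.E) = τ :=
      ⟨Finset.univ.filter fun a => (a : α) ∈ τ, by
        ext a
        simp only [Finset.coe_filter, Finset.mem_univ, true_and, Set.mem_image, Set.mem_ofPred_eq]
        exact ⟨by rintro ⟨b, hb, rfl⟩; exact hb, fun ha => ⟨⟨a, hτ ha⟩, ha, rfl⟩⟩⟩
    rw [Subtype.val_injective.encard_image, Set.encard_coe_eq_coe_finsetCard] at hi ⊢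
    have hr : M.eRk (Subtype.val '' (τ : Set M.E)) ≠ ⊤ := fun ht => by
      rw [ht, top_add] at hi
      exact ENat.natCast_ne_top _ hi
    have hi' := h.encard_eq_eRk_add τ
    rw [hi] at hi'
    have hi2 : i = (𝒞.filter (· ⊆ τ)).card :=
      Nat.cast_injective (R := ℕ∞) ((WithTop.add_left_inj hr).1 hi')
    -- Conversely, `τ` contains the disjoint union of the `i` circuits inside it, which bounds its
    -- size from below.
    have hle : minWeight 𝒞 Finset.card i ≤ ((∑ C ∈ 𝒞.filter (· ⊆ τ), C.card : ℕ) : ℕ∞) :=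
      sInf_le ⟨𝒞.filter (· ⊆ τ), Finset.filter_subset _ _, hi2.symm, rfl⟩
    refine hle.trans ?_
    have hcard : ((𝒞.filter (· ⊆ τ)).biUnion id).card = ∑ C ∈ 𝒞.filter (· ⊆ τ), C.card :=
      Finset.card_biUnion fun C hC D hD hne =>
        h.disjoint (Finset.mem_filter.1 hC).1 (Finset.mem_filter.1 hD).1 hne
    rw [Nat.cast_le, ← hcard]
    exact Finset.card_le_card (Finset.biUnion_subset.2 fun C hC => (Finset.mem_filter.1 hC).2)

-- An independent set misses a point of every circuit. It therefore lies in the complement of a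
-- transversal, which is a base, and nested bases coincide.
open Classical in
lemma isBase_iff [Fintype M.E] (h : HasDisjointCircuits M 𝒞) (σ : Finset M.E) :
    M.IsBase (Subtype.val '' (σ : Set M.E)) ↔
      ∃ g : 𝒞 → M.E, (∀ C, g C ∈ C.1) ∧ σ = Finset.univ \ Finset.univ.image g := by
  have hchoice : ∀ g : 𝒞 → M.E, (∀ C, g C ∈ C.1) → M.IsBase (Subtype.val ''
      ((Finset.univ \ Finset.univ.image g : Finset M.E) : Set M.E)) := by
    intro g hg
    have hb := h.isBasis_sdiff_image hg Finset.univ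
    rw [Finset.coe_univ, Set.image_univ, Subtype.range_val, Matroid.isBasis_ground_iff] at hb
    simpa using hb
  constructor
  · intro hσ
    have hind := (h.indep_iff σ).1 hσ.indep
    choose g hg hgσ using fun C : 𝒞 => Finset.not_subset.1 (hind C C.2)
    refine ⟨g, hg, ?_⟩
    have hsub : σ ⊆ Finset.univ \ Finset.univ.image g := by
      intro a ha
      refine Finset.mem_sdiff.2 ⟨Finset.mem_univ a, fun hai => ?_⟩
      obtain ⟨C, -, rfl⟩ := Finset.mem_image.1 hai
      exact hgσ C ha
    have := hσ.eq_of_subset_isBase (hchoice g hg) (Set.image_mono (Finset.coe_subset.2 hsub))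
    exact Finset.coe_injective (Subtype.val_injective.image_injective this)
  · rintro ⟨g, hg, rfl⟩
    exact hchoice g hg

open Classical in
lemma prod_univ_sdiff_image [Fintype M.E] (h : HasDisjointCircuits M 𝒞) {g : 𝒞 → M.E}
    (hg : ∀ C, g C ∈ C.1) {A : Type*} [CommMonoid A] (x : M.E → A) :
    ∏ e ∈ Finset.univ \ Finset.univ.image g, x e =
      (∏ e ∈ Finset.univ \ 𝒞.biUnion id, x e) * ∏ C : 𝒞, ∏ e ∈ C.1.erase (g C), x e := by
  have hdisj : ((Finset.univ : Finset 𝒞) : Set 𝒞).PairwiseDisjoint fun C => C.1.erase (g C) :=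
    fun C _ D _ hne => (h.disjoint C.2 D.2 fun heq => hne (Subtype.ext heq)).mono
      (Finset.erase_subset _ _) (Finset.erase_subset _ _)
  rw [← Finset.prod_biUnion hdisj, ← Finset.prod_union]
  · congr 1
    ext a
    simp only [Finset.mem_sdiff, Finset.mem_univ, true_and, Finset.mem_image, not_exists,
      not_and, Finset.mem_union, Finset.mem_biUnion, id, Finset.mem_erase]
    constructor
    · intro ha
      by_cases hex : ∃ C ∈ 𝒞, a ∈ C
      · obtain ⟨C, hC, haC⟩ := hex
        exact Or.inr ⟨⟨C, hC⟩, fun he => ha _ he.symm, haC⟩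
      · exact Or.inl fun C hC haC => hex ⟨C, hC, haC⟩
    · rintro (ha | ⟨C, hne, haC⟩) D rfl
      · exact ha D D.2 (hg D)
      · exact hne (congrArg g (Subtype.ext (h.eq_of_mem C.2 D.2 haC (hg D)))).symm
  · rw [Finset.disjoint_left]
    intro a ha ha'
    obtain ⟨C, -, haC⟩ := Finset.mem_biUnion.1 ha'
    exact (Finset.mem_sdiff.1 ha).2
      (Finset.mem_biUnion.2 ⟨C, C.2, Finset.mem_of_mem_erase haC⟩)

open Classical in
/-- The facet ideal of a matroid with disjoint circuits is a product. -/
lemma facetIdeal_eq (k : Type*) [Field k] [Fintype M.E] (h : HasDisjointCircuits M 𝒞) :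
    M.facetIdeal k = Ideal.span {∏ e ∈ Finset.univ \ 𝒞.biUnion id, X e} *
      ∏ C ∈ 𝒞, circuitIdeal k C := by
  rw [← Finset.prod_coe_sort 𝒞 fun C => circuitIdeal k C]
  simp only [circuitIdeal_eq]
  -- A generator of the product is a choice of one generator per circuit, that is, of one omitted
  -- point per circuit, and so corresponds to a base.
  rw [Ideal.prod_span, Ideal.span_mul_span', Matroid.facetIdeal, Set.singleton_mul]
  congr 1
  ext p
  simp only [Set.mem_ofPred_eq, Set.mem_image, Set.mem_fintype_prod, h.isBase_iff]
  constructor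
  · rintro ⟨_, ⟨g, hg, rfl⟩, rfl⟩
    exact ⟨_, ⟨fun C => ∏ e ∈ C.1.erase (g C), X e, fun C => ⟨g C, hg C, rfl⟩, rfl⟩,
      (h.prod_univ_sdiff_image hg _).symm⟩
  · rintro ⟨_, ⟨q, hq, rfl⟩, rfl⟩
    choose g hg hgq using hq
    refine ⟨_, ⟨g, hg, rfl⟩, ?_⟩
    rw [h.prod_univ_sdiff_image hg]
    simp only [hgq]

lemma isBettiSequence (k : Type*) [Field k] [Finite M.E] (h : HasDisjointCircuits M 𝒞) :
    IsBettiSequence (ι := M.E) (k := k) (M.facetIdeal k)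
      (circuitBettiPoly 𝒞 Finset.card).coeff := by
  classical
  have := Fintype.ofFinite M.E
  have key := hasMinimalResolution_prod_circuitIdeal (k := k) (Finset.univ \ 𝒞.biUnion id) 𝒞
    h.nonempty h.disjoint fun C hC => Finset.disjoint_left.2 fun a ha ha' =>
      (Finset.mem_sdiff.1 ha').2 (Finset.mem_biUnion.2 ⟨C, hC, ha⟩)
  rw [← h.facetIdeal_eq k] at key
  exact key

end HasDisjointCircuits

lemma IsBettiSequence.unique {ι k : Type*} [Field k] {I : Ideal (MvPolynomial ι k)} {β γ : ℕ → ℕ}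
    (hβ : IsBettiSequence (ι := ι) (k := k) I β) (hγ : IsBettiSequence (ι := ι) (k := k) I γ) :
    β = γ :=
  HasMinimalResolution.unique span_range_X_ne_top hβ hγ

end DisjointCircuits

/-! ### Cactus graphs -/

namespace Graph

variable {α β : Type*} {G : Graph α β}

lemma IsCycleSet.nonempty {C : Set β} (hC : G.IsCycleSet C) : C.Nonempty := by
  obtain ⟨n, v, e, -, -, -, rfl⟩ := hC
  exact Set.range_nonempty e

lemma IsCycleSet.two_le_encard (hG : G.Loopless) {C : Set β} (hC : G.IsCycleSet C) :
    2 ≤ C.encard := by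
  obtain ⟨n, v, e, -, he, hl, rfl⟩ := hC
  rcases n with _ | n
  · exact absurd (hl 0) (hG.not_isLoopAt (e 0) (v 0))
  · rw [← Set.image_univ, he.encard_image, Set.encard_univ]
    simp only [ENat.card_eq_coe_fintype_card, Fintype.card_fin]
    exact_mod_cast (by omega : 2 ≤ n + 1 + 1)

lemma IsCactus.exists_hasDisjointCircuits (hG : G.IsCactus) :
    ∃ 𝒞 : Finset (Finset G.cycleMatroid.E), HasDisjointCircuits G.cycleMatroid 𝒞 ∧
      (G.Loopless → ∀ C ∈ 𝒞, 2 ≤ C.card) := by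
  classical
  have : Finite G.cycleMatroid.E := hG.finite_edgeSet
  have := Fintype.ofFinite G.cycleMatroid.E
  refine ⟨Finset.univ.filter fun C : Finset G.cycleMatroid.E =>
    G.IsCycleSet (Subtype.val '' (C : Set G.cycleMatroid.E)), ⟨?_, ?_, ?_⟩, ?_⟩
  · intro C hC
    exact Finset.coe_nonempty.1 (Set.image_nonempty.1 (Finset.mem_filter.1 hC).2.nonempty)
  · intro C hC D hD hne
    have hd := hG.disjoint_cycles _ _ (Finset.mem_filter.1 hC).2 (Finset.mem_filter.1 hD).2
      fun heq => hne (Finset.coe_injective (Subtype.val_injective.image_injective heq))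
    rw [Set.disjoint_image_iff Subtype.val_injective, Finset.disjoint_coe] at hd
    exact hd
  · intro s
    rw [cycleMatroid_indep]
    constructor
    · rintro ⟨-, hs⟩ C hC hsub
      exact hs _ (Set.image_mono (Finset.coe_subset.2 hsub)) (Finset.mem_filter.1 hC).2
    · refine fun hs => ⟨by rintro _ ⟨b, -, rfl⟩; exact b.2, fun C hsub hC => ?_⟩
      obtain ⟨D, hD, rfl⟩ := Set.subset_image_iff.1 hsub
      refine hs D.toFinset (Finset.mem_filter.2 ⟨Finset.mem_univ _, ?_⟩) ?_
      · rwa [Set.coe_toFinset]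
      · intro a ha
        exact hD (Set.mem_toFinset.1 ha)
  · intro hloop C hC
    have h2 := (Finset.mem_filter.1 hC).2.two_le_encard hloop
    rw [Subtype.val_injective.encard_image, Set.encard_coe_eq_coe_finsetCard] at h2
    exact_mod_cast h2

end Graph

theorem theorem5p2 {k : Type*} [Field k] {V₁ E₁ V₂ E₂ : Type*}
    (G : Graph V₁ E₁) (H : Graph V₂ E₂) (hG : G.IsCactus) (hH : H.IsCactus) :
    (∃! β : ℕ → ℕ,
      IsBettiSequence (ι := G.cycleMatroid.E) (k := k) (G.cycleMatroid.facetIdeal k) β) ∧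
    (∃! γ : ℕ → ℕ,
      IsBettiSequence (ι := H.cycleMatroid.E) (k := k) (H.cycleMatroid.facetIdeal k) γ) ∧
    ∀ β γ : ℕ → ℕ,
      IsBettiSequence (ι := G.cycleMatroid.E) (k := k) (G.cycleMatroid.facetIdeal k) β →
      IsBettiSequence (ι := H.cycleMatroid.E) (k := k) (H.cycleMatroid.facetIdeal k) γ →
      (G.Loopless → H.Loopless → (∀ i, β i = γ i) →
        ∀ i, G.cycleMatroid.higherWeight i = H.cycleMatroid.higherWeight i) ∧
      ((∀ i, G.cycleMatroid.higherWeight i = H.cycleMatroid.higherWeight i) →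
        ∀ i, β i = γ i) := by
  have : Finite G.cycleMatroid.E := hG.finite_edgeSet
  have : Finite H.cycleMatroid.E := hH.finite_edgeSet
  obtain ⟨𝒞, h𝒞, hl𝒞⟩ := hG.exists_hasDisjointCircuits
  obtain ⟨𝒟, h𝒟, hl𝒟⟩ := hH.exists_hasDisjointCircuits
  refine ⟨⟨_, h𝒞.isBettiSequence k, fun β hβ => IsBettiSequence.unique hβ (h𝒞.isBettiSequence k)⟩,
    ⟨_, h𝒟.isBettiSequence k, fun γ hγ => IsBettiSequence.unique hγ (h𝒟.isBettiSequence k)⟩, fun β γ hβ hγ => ?_⟩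
  -- By uniqueness both sequences may be taken to be the coefficients of the circuit polynomials.
  obtain rfl := IsBettiSequence.unique hβ (h𝒞.isBettiSequence k)
  obtain rfl := IsBettiSequence.unique hγ (h𝒟.isBettiSequence k)
  simp only [h𝒞.higherWeight_eq, h𝒟.higherWeight_eq]
  refine ⟨fun hG' hH' h => minWeight_eq_of_map_eq (map_eq_of_circuitBettiPoly_eq (hl𝒞 hG')
    (hl𝒟 hH') (Polynomial.ext h)), fun h i => ?_⟩
  rw [circuitBettiPoly_eq_of_map_eq (map_eq_of_minWeight_eq _ 𝒞 _ 𝒟 _ rfl h)]
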